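/- Let $1<\alpha<2$. For each $N\ge 1$ let $(J_{ij})_{1\le i<j\le N}$ be i.i.d. real random variables with density $$\frac{\alpha}{2N}\,\frac{\mathbf 1_{\{|x|\ge N^{-1/\alpha}\}}}{|x|^{\alpha+1}} .$$ For $\beta>0$ let $G_N$ be the random Gibbs measure on $\{-1,1\}^N$ given by $$G_N(\sigma)=\frac{1}{Z_N}\exp\Bigl(\beta\sum_{1\le i<j\le N}J_{ij}\sigma_i\sigma_j\Bigr),\qquad Z_N=\sum_{\sigma\in\{-1,1\}^N}\exp\Bigl(\beta\sum_{1\le i<j\le N}J_{ij}\sigma_i\sigma_j\Bigr).$$ Let $\sigma^1,\sigma^2,\dots$ be independent samples from $G_N$ (given the $J_{ij}$), let $\langle\cdot\rangle$ denote the expectation over these samples, and let $\mathbb E$ denote the expectation over the $J_{ij}$. Define the site overlaps $$R_k=\frac1N\sum_{i=1}^N\sigma^1_i\sigma^2_i\cdots\sigma^k_i\qquad(k\ge1),$$ and, for $K>0$, with $M=\sum_{i<j}\mathbf 1_{\{|J_{ij}|\ge K\}}$, the bond overlap $$Q_K=\frac1M\sum_{i<j}\mathbf 1_{\{|J_{ij}|\ge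 K\}}\,\sigma^1_i\sigma^1_j\sigma^2_i\sigma^2_j\ \text{ if } M\ge1,\qquad Q_K=0\ \text{ if } M=0 .$$ Let $$\beta_\alpha=\Bigl(\alpha\int_0^\infty\frac{\tanh^2(x)}{x^{\alpha+1}}\,dx\Bigr)^{-1/\alpha}.$$ Assume $0<\beta<\beta_\alpha$. Then for every integer $k\ge1$, $$\lim_{N\to\infty}\mathbb E\bigl\langle R_{2k}^2\bigr\rangle=0 .$$ Moreover, for every $K>0$, the number $q_K=\alpha K^{\alpha}\int_K^\infty \frac{\tanh^2(\beta x)}{x^{1+\alpha}}\,dx$ is strictly positive and $$\lim_{N\to\infty}\mathbb E\bigl\langle (Q_K-q_K)^2\bigr\rangle=0 .$$ -/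

import Mathlib

open MeasureTheory ProbabilityTheory Filter Topology

noncomputable section

namespace LevyModel

/-- The law of the disorder variable `J` at system size `N`: density
`α / (2N) * 1{|x| ≥ N^(-1/α)} / |x|^(α+1)` with respect to Lebesgue measure. -/
def disorderLaw (α : ℝ) (N : ℕ) : Measure ℝ :=
  volume.withDensity fun x =>
    ENNReal.ofReal
      (if (N : ℝ) ^ (-1 / α) ≤ |x| then α / (2 * N) * (1 / |x| ^ (α + 1)) else 0)

/-- The pairs `(i, j)` of vertices with `i < j`. -/
abbrev Edge (N : ℕ) : Type := {e : Fin N × Fin N // e.1 < e.2}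

/-- Spin configurations: `ℤˣ = {1, -1}`. -/
abbrev Config (N : ℕ) : Type := Fin N → ℤˣ

/-- The value `±1` of the spin at site `i`, as a real number. -/
def spin {N : ℕ} (σ : Config N) (i : Fin N) : ℝ := ((σ i : ℤ) : ℝ)

/-- `-H_N(σ) = β ∑_{i<j} J_ij σ_i σ_j`. -/
def negHamiltonian {N : ℕ} (β : ℝ) (J : Edge N → ℝ) (σ : Config N) : ℝ :=
  β * ∑ e : Edge N, J e * spin σ e.1.1 * spin σ e.1.2

/-- The partition function `Z_N(β)`. -/
def partitionFunction {N : ℕ} (β : ℝ) (J : Edge N → ℝ) : ℝ :=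
  ∑ σ : Config N, Real.exp (negHamiltonian β J σ)

/-- The Gibbs weight `G_N(σ)`. -/
def gibbsWeight {N : ℕ} (β : ℝ) (J : Edge N → ℝ) (σ : Config N) : ℝ :=
  Real.exp (negHamiltonian β J σ) / partitionFunction β J

/-- The Gibbs expectation `⟨f(σ¹, …, σⁿ)⟩` of a function of `n` replicas, that is, of `n`
independent samples from the Gibbs measure, at fixed disorder `J`. -/
def gibbsExp {N n : ℕ} (β : ℝ) (J : Edge N → ℝ) (f : (Fin n → Config N) → ℝ) : ℝ :=
  ∑ τ : Fin n → Config N, (∏ l, gibbsWeight β J (τ l)) * f τ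

/-- The site multi-overlap `R_k = N⁻¹ ∑_i σ¹_i ⋯ σᵏ_i`. -/
def siteOverlap {N k : ℕ} (τ : Fin k → Config N) : ℝ :=
  1 / (N : ℝ) * ∑ i : Fin N, ∏ l : Fin k, spin (τ l) i

open Classical in
/-- The number `M` of edges with `|J_ij| ≥ K`. -/
def heavyCount {N : ℕ} (K : ℝ) (J : Edge N → ℝ) : ℕ :=
  ∑ e : Edge N, if K ≤ |J e| then 1 else 0

open Classical in
/-- The bond overlap `Q_K(σ¹, σ²)`, equal to `0` if no edge is heavy. -/
def bondOverlap {N : ℕ} (K : ℝ) (J : Edge N → ℝ) (σ₁ σ₂ : Config N) : ℝ :=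
  if 1 ≤ heavyCount K J then
    1 / (heavyCount K J : ℝ) *
      ∑ e : Edge N, if K ≤ |J e| then
        spin σ₁ e.1.1 * spin σ₁ e.1.2 * spin σ₂ e.1.1 * spin σ₂ e.1.2 else 0
  else 0

/-- The critical inverse temperature `β_α`. -/
def criticalBeta (α : ℝ) : ℝ :=
  (α * ∫ x in Set.Ioi (0 : ℝ), Real.tanh x ^ 2 / x ^ (α + 1)) ^ (-1 / α)

/-- The limit `α K^α ∫_K^∞ tanh²(βx) x^(-1-α) dx` of the bond overlap. -/
def bondLimit (α β K : ℝ) : ℝ :=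
  α * K ^ α * ∫ x in Set.Ioi K, Real.tanh (β * x) ^ 2 / x ^ (1 + α)

end LevyModel

end

noncomputable section

namespace LevyModel

section Deterministic

variable {N : ℕ}

/-! ### Hyperbolic tangent -/

theorem continuous_tanh : Continuous Real.tanh := by
  have : Real.tanh = fun x => Real.sinh x / Real.cosh x := by
    funext x; exact Real.tanh_eq_sinh_div_cosh x
  rw [this]
  exact Real.continuous_sinh.div Real.continuous_cosh fun x => (Real.cosh_pos x).ne'

theorem measurable_tanh : Measurable Real.tanh := continuous_tanh.measurable

theorem tanh_pos {x : ℝ} (hx : 0 < x) : 0 < Real.tanh x := by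
  rw [Real.tanh_eq_sinh_div_cosh]
  exact div_pos (Real.sinh_pos_iff.2 hx) (Real.cosh_pos x)

theorem tanh_nonneg {x : ℝ} (hx : 0 ≤ x) : 0 ≤ Real.tanh x := by
  rw [Real.tanh_eq_sinh_div_cosh]
  exact div_nonneg (Real.sinh_nonneg_iff.2 hx) (Real.cosh_pos x).le

theorem tanh_mono : Monotone Real.tanh := by
  intro x y h
  rw [Real.tanh_eq_sinh_div_cosh, Real.tanh_eq_sinh_div_cosh,
    div_le_div_iff₀ (Real.cosh_pos x) (Real.cosh_pos y)]
  have := Real.sinh_nonneg_iff.2 (sub_nonneg.2 h)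
  rw [Real.sinh_sub] at this
  linarith

theorem tanh_abs (x : ℝ) : Real.tanh |x| = |Real.tanh x| := by
  rcases le_total 0 x with h | h
  · rw [abs_of_nonneg h, abs_of_nonneg (tanh_nonneg h)]
  · rw [abs_of_nonpos h, Real.tanh_neg, abs_of_nonpos]
    have := tanh_nonneg (neg_nonneg.2 h)
    rw [Real.tanh_neg] at this
    linarith

theorem tanh_le_self {x : ℝ} (hx : 0 ≤ x) : Real.tanh x ≤ x := by
  have hd : ∀ y : ℝ, HasDerivAt (fun y => y * Real.cosh y - Real.sinh y)
      (1 * Real.cosh y + y * Real.sinh y - Real.cosh y) y := fun y =>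
    ((hasDerivAt_id y).mul (Real.hasDerivAt_cosh y)).sub (Real.hasDerivAt_sinh y)
  have hm : MonotoneOn (fun y => y * Real.cosh y - Real.sinh y) (Set.Ici 0) := by
    apply monotoneOn_of_deriv_nonneg (convex_Ici 0)
    · exact fun y _ => (hd y).continuousAt.continuousWithinAt
    · exact fun y _ => (hd y).differentiableAt.differentiableWithinAt
    · intro y hy
      rw [interior_Ici] at hy
      rw [(hd y).deriv]
      have := mul_nonneg (le_of_lt hy) (Real.sinh_nonneg_iff.2 (le_of_lt hy))
      linarith
  have := hm (Set.self_mem_Ici) (Set.mem_Ici.2 hx) hx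
  simp only [Real.sinh_zero, zero_mul, sub_zero] at this
  rw [Real.tanh_eq_sinh_div_cosh, div_le_iff₀ (Real.cosh_pos x)]
  linarith

theorem exp_mul_sign (x s : ℝ) (hs : s = 1 ∨ s = -1) :
    Real.exp (x * s) = Real.cosh x * (1 + Real.tanh x * s) := by
  rw [Real.tanh_eq_sinh_div_cosh]
  have hc := (Real.cosh_pos x).ne'
  rcases hs with rfl | rfl
  · rw [mul_one, ← Real.cosh_add_sinh]; field_simp
  · rw [mul_neg_one, ← Real.cosh_sub_sinh]; field_simp; ring

/-! ### Spins -/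

theorem spin_eq (σ : Config N) (i : Fin N) : spin σ i = 1 ∨ spin σ i = -1 := by
  rcases Int.units_eq_one_or (σ i) with h | h <;> simp [spin, h]

theorem abs_spin (σ : Config N) (i : Fin N) : |spin σ i| = 1 := by
  rcases spin_eq σ i with h | h <;> simp [h]

/-- The product of the two spins at the ends of an edge. -/
def edgeSpin (σ : Config N) (e : Edge N) : ℝ := spin σ e.1.1 * spin σ e.1.2

theorem edgeSpin_eq (σ : Config N) (e : Edge N) : edgeSpin σ e = 1 ∨ edgeSpin σ e = -1 := by
  rcases spin_eq σ e.1.1 with h | h <;> rcases spin_eq σ e.1.2 with h' | h' <;>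
    simp [edgeSpin, h, h']

theorem edgeSpin_mul_self (σ : Config N) (e : Edge N) : edgeSpin σ e * edgeSpin σ e = 1 := by
  rcases edgeSpin_eq σ e with h | h <;> simp [h]

theorem abs_edgeSpin (σ : Config N) (e : Edge N) : |edgeSpin σ e| = 1 := by
  rcases edgeSpin_eq σ e with h | h <;> simp [h]

/-! ### Gibbs means -/

/-- The unnormalised Gibbs sum of an observable. -/
def gibbsSum (β : ℝ) (J : Edge N → ℝ) (f : Config N → ℝ) : ℝ :=
  ∑ σ : Config N, Real.exp (negHamiltonian β J σ) * f σ

/-- The Gibbs mean of an observable of one replica. -/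
def gibbsMean (β : ℝ) (J : Edge N → ℝ) (f : Config N → ℝ) : ℝ :=
  ∑ σ : Config N, gibbsWeight β J σ * f σ

theorem negHamiltonian_eq (β : ℝ) (J : Edge N → ℝ) (σ : Config N) :
    negHamiltonian β J σ = β * ∑ e, J e * edgeSpin σ e := by
  simp [negHamiltonian, edgeSpin, mul_assoc]

theorem partitionFunction_pos (β : ℝ) (J : Edge N → ℝ) : 0 < partitionFunction β J :=
  Finset.sum_pos (fun _ _ => Real.exp_pos _) Finset.univ_nonempty

theorem gibbsWeight_nonneg (β : ℝ) (J : Edge N → ℝ) (σ : Config N) : 0 ≤ gibbsWeight β J σ :=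
  div_nonneg (Real.exp_pos _).le (partitionFunction_pos β J).le

theorem sum_gibbsWeight (β : ℝ) (J : Edge N → ℝ) : ∑ σ, gibbsWeight β J σ = 1 := by
  simp only [gibbsWeight]
  rw [← Finset.sum_div]
  exact div_self (partitionFunction_pos β J).ne'

theorem gibbsMean_eq_div (β : ℝ) (J : Edge N → ℝ) (f : Config N → ℝ) :
    gibbsMean β J f = gibbsSum β J f / partitionFunction β J := by
  simp only [gibbsMean, gibbsSum, gibbsWeight, Finset.sum_div]
  exact Finset.sum_congr rfl fun σ _ => by ring

theorem abs_gibbsMean_le (β : ℝ) (J : Edge N → ℝ) {f : Config N → ℝ} {C : ℝ}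
    (hf : ∀ σ, |f σ| ≤ C) : |gibbsMean β J f| ≤ C := by
  calc |gibbsMean β J f| ≤ ∑ σ, |gibbsWeight β J σ * f σ| := Finset.abs_sum_le_sum_abs _ _
    _ ≤ ∑ σ, gibbsWeight β J σ * C := by
        refine Finset.sum_le_sum fun σ _ => ?_
        rw [abs_mul, abs_of_nonneg (gibbsWeight_nonneg β J σ)]
        exact mul_le_mul_of_nonneg_left (hf σ) (gibbsWeight_nonneg β J σ)
    _ = C := by rw [← Finset.sum_mul, sum_gibbsWeight, one_mul]

theorem abs_gibbsMean_edgeSpin_le (β : ℝ) (J : Edge N → ℝ) (e : Edge N) :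
    |gibbsMean β J fun σ => edgeSpin σ e| ≤ 1 :=
  abs_gibbsMean_le β J fun σ => (abs_edgeSpin σ e).le

theorem abs_gibbsMean_edgeSpin_mul_le (β : ℝ) (J : Edge N → ℝ) (e e' : Edge N) :
    |gibbsMean β J fun σ => edgeSpin σ e * edgeSpin σ e'| ≤ 1 :=
  abs_gibbsMean_le β J fun σ => by simp [abs_mul, abs_edgeSpin]

theorem exp_negHamiltonian_update (β : ℝ) (J : Edge N → ℝ) (e : Edge N) (σ : Config N) :
    Real.exp (negHamiltonian β J σ) = Real.cosh (β * J e) *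
      (Real.exp (negHamiltonian β (Function.update J e 0) σ) *
        (1 + Real.tanh (β * J e) * edgeSpin σ e)) := by
  have h : negHamiltonian β J σ
      = negHamiltonian β (Function.update J e 0) σ + β * J e * edgeSpin σ e := by
    rw [negHamiltonian_eq, negHamiltonian_eq, ← Finset.add_sum_erase _ _ (Finset.mem_univ e),
      ← Finset.add_sum_erase Finset.univ (fun e' => Function.update J e 0 e' * edgeSpin σ e')
        (Finset.mem_univ e)]
    have : ∑ x ∈ Finset.univ.erase e, Function.update J e 0 x * edgeSpin σ x
        = ∑ x ∈ Finset.univ.erase e, J x * edgeSpin σ x :=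
      Finset.sum_congr rfl fun x hx => by
        rw [Function.update_of_ne (Finset.ne_of_mem_erase hx)]
    rw [this, Function.update_self]
    ring
  rw [h, Real.exp_add, exp_mul_sign _ _ (edgeSpin_eq σ e)]
  ring

/-- The effect of one coupling on a Gibbs mean. -/
theorem gibbsMean_mul_update (β : ℝ) (J : Edge N → ℝ) (e : Edge N) (f : Config N → ℝ) :
    gibbsMean β J f * (1 + Real.tanh (β * J e) *
        gibbsMean β (Function.update J e 0) fun σ => edgeSpin σ e)
      = gibbsMean β (Function.update J e 0) f + Real.tanh (β * J e) *
        gibbsMean β (Function.update J e 0) fun σ => f σ * edgeSpin σ e := by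
  set J' := Function.update J e 0
  set t := Real.tanh (β * J e)
  set c := Real.cosh (β * J e)
  have hc : c ≠ 0 := (Real.cosh_pos _).ne'
  have h1 : gibbsSum β J f = c * (gibbsSum β J' f + t * gibbsSum β J' fun σ => f σ * edgeSpin σ e) := by
    simp only [gibbsSum, Finset.mul_sum, ← Finset.sum_add_distrib]
    refine Finset.sum_congr rfl fun σ _ => ?_
    rw [exp_negHamiltonian_update β J e σ]
    ring
  have h2 : partitionFunction β J
      = c * (partitionFunction β J' + t * gibbsSum β J' fun σ => edgeSpin σ e) := by
    simp only [gibbsSum, partitionFunction, Finset.mul_sum, ← Finset.sum_add_distrib]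
    refine Finset.sum_congr rfl fun σ _ => ?_
    rw [exp_negHamiltonian_update β J e σ]
    ring
  have hZ := (partitionFunction_pos β J).ne'
  have hZ' := (partitionFunction_pos β J').ne'
  simp only [gibbsMean_eq_div]
  rw [h1]
  rw [h2] at hZ ⊢
  have := right_ne_zero_of_mul hZ
  field_simp

/-- The mean of a product over replicas factorises. -/
theorem gibbsExp_prod {n : ℕ} (β : ℝ) (J : Edge N → ℝ) (f : Fin n → Config N → ℝ) :
    gibbsExp β J (fun τ : Fin n → Config N => ∏ l, f l (τ l)) = ∏ l, gibbsMean β J (f l) := by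
  simp only [gibbsExp, gibbsMean, ← Finset.prod_mul_distrib]
  rw [Finset.prod_univ_sum, Fintype.piFinset_univ]

theorem gibbsExp_sum {n : ℕ} {ι : Type*} (s : Finset ι) (β : ℝ) (J : Edge N → ℝ)
    (f : ι → (Fin n → Config N) → ℝ) :
    gibbsExp β J (fun τ => ∑ i ∈ s, f i τ) = ∑ i ∈ s, gibbsExp β J (f i) := by
  simp only [gibbsExp, Finset.mul_sum]
  exact Finset.sum_comm

theorem gibbsExp_const_mul {n : ℕ} (β : ℝ) (J : Edge N → ℝ) (c : ℝ)
    (f : (Fin n → Config N) → ℝ) :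
    gibbsExp β J (fun τ => c * f τ) = c * gibbsExp β J f := by
  simp only [gibbsExp, Finset.mul_sum]
  exact Finset.sum_congr rfl fun _ _ => by ring

theorem gibbsExp_one {n : ℕ} (β : ℝ) (J : Edge N → ℝ) :
    gibbsExp β J (fun _ : Fin n → Config N => 1) = 1 := by
  have := gibbsExp_prod (n := n) β J fun _ _ => 1
  simpa [gibbsMean, sum_gibbsWeight] using this

theorem gibbsExp_mono {n : ℕ} (β : ℝ) (J : Edge N → ℝ) {f g : (Fin n → Config N) → ℝ}
    (h : ∀ τ, f τ ≤ g τ) : gibbsExp β J f ≤ gibbsExp β J g :=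
  Finset.sum_le_sum fun τ _ => mul_le_mul_of_nonneg_left (h τ)
    (Finset.prod_nonneg fun _ _ => gibbsWeight_nonneg β J _)

theorem gibbsExp_add {n : ℕ} (β : ℝ) (J : Edge N → ℝ) (f g : (Fin n → Config N) → ℝ) :
    gibbsExp β J (fun τ => f τ + g τ) = gibbsExp β J f + gibbsExp β J g := by
  simp only [gibbsExp, mul_add, Finset.sum_add_distrib]

theorem gibbsExp_two_mul (β : ℝ) (J : Edge N → ℝ) (f g : Config N → ℝ) :
    gibbsExp β J (fun τ : Fin 2 → Config N => f (τ 0) * g (τ 1))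
      = gibbsMean β J f * gibbsMean β J g := by
  have := gibbsExp_prod (n := 2) β J ![f, g]
  simpa [Fin.prod_univ_two] using this

/-! ### Overlap moments as sums of squared correlations -/

/-- The mean of the squared overlap of two replicas. -/
def overlapSq (β : ℝ) (J : Edge N → ℝ) : ℝ :=
  gibbsExp β J fun τ : Fin 2 → Config N => siteOverlap τ ^ 2

theorem siteOverlap_sq {k : ℕ} (τ : Fin k → Config N) :
    siteOverlap τ ^ 2 = (1 / (N : ℝ)) ^ 2 *
      ∑ i : Fin N, ∑ j : Fin N, ∏ l, (spin (τ l) i * spin (τ l) j) := by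
  rw [siteOverlap, mul_pow, sq (∑ i : Fin N, _), Finset.sum_mul_sum]
  simp [Finset.prod_mul_distrib]

theorem gibbsExp_siteOverlap_sq (k : ℕ) (β : ℝ) (J : Edge N → ℝ) :
    gibbsExp β J (fun τ : Fin k → Config N => siteOverlap τ ^ 2) = (1 / (N : ℝ)) ^ 2 *
      ∑ i : Fin N, ∑ j : Fin N, (gibbsMean β J fun σ => spin σ i * spin σ j) ^ k := by
  simp only [siteOverlap_sq]
  rw [gibbsExp_const_mul, gibbsExp_sum]
  congr 1
  refine Finset.sum_congr rfl fun i _ => ?_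
  rw [gibbsExp_sum]
  refine Finset.sum_congr rfl fun j _ => ?_
  rw [gibbsExp_prod β J fun (_ : Fin k) σ => spin σ i * spin σ j]
  simp

theorem abs_siteOverlap_le {k : ℕ} (τ : Fin k → Config N) : |siteOverlap τ| ≤ 1 := by
  rw [siteOverlap, abs_mul]
  have h : |∑ i : Fin N, ∏ l : Fin k, spin (τ l) i| ≤ N := by
    refine (Finset.abs_sum_le_sum_abs _ _).trans ?_
    simp [Finset.abs_prod, abs_spin]
  rcases Nat.eq_zero_or_pos N with rfl | hN
  · simp
  · have hN' : (0 : ℝ) < N := by exact_mod_cast hN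
    rw [abs_of_pos (by positivity), one_div, inv_mul_le_iff₀ hN', mul_one]
    exact h

theorem gibbsExp_siteOverlap_sq_le (k : ℕ) (hk : 1 ≤ k) (β : ℝ) (J : Edge N → ℝ) :
    gibbsExp β J (fun τ : Fin (2 * k) → Config N => siteOverlap τ ^ 2) ≤ overlapSq β J := by
  rw [overlapSq, gibbsExp_siteOverlap_sq, gibbsExp_siteOverlap_sq]
  refine mul_le_mul_of_nonneg_left ?_ (by positivity)
  refine Finset.sum_le_sum fun i _ => Finset.sum_le_sum fun j _ => ?_
  have h : |gibbsMean β J fun σ => spin σ i * spin σ j| ≤ 1 :=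
    abs_gibbsMean_le β J fun σ => by simp [abs_mul, abs_spin]
  rw [← (even_two.mul_right k).pow_abs, ← even_two.pow_abs]
  exact pow_le_pow_of_le_one (abs_nonneg _) h (by omega)

theorem gibbsExp_nonneg {n : ℕ} (β : ℝ) (J : Edge N → ℝ) {f : (Fin n → Config N) → ℝ}
    (h : ∀ τ, 0 ≤ f τ) : 0 ≤ gibbsExp β J f :=
  Finset.sum_nonneg fun τ _ => mul_nonneg
    (Finset.prod_nonneg fun _ _ => gibbsWeight_nonneg β J _) (h τ)

theorem gibbsExp_le_of_le {n : ℕ} (β : ℝ) (J : Edge N → ℝ) {f : (Fin n → Config N) → ℝ} {C : ℝ}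
    (h : ∀ τ, f τ ≤ C) : gibbsExp β J f ≤ C := by
  calc gibbsExp β J f ≤ gibbsExp β J (fun _ => C * 1) := gibbsExp_mono β J fun τ => by
        simpa using h τ
    _ = C := by rw [gibbsExp_const_mul, gibbsExp_one, mul_one]

theorem overlapSq_nonneg (β : ℝ) (J : Edge N → ℝ) : 0 ≤ overlapSq β J :=
  gibbsExp_nonneg β J fun _ => sq_nonneg _

theorem overlapSq_le_one (β : ℝ) (J : Edge N → ℝ) : overlapSq β J ≤ 1 :=
  gibbsExp_le_of_le β J fun τ => by
    rw [← sq_abs]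
    exact pow_le_one₀ (abs_nonneg _) (abs_siteOverlap_le τ)

theorem sum_edge_le_sum_pair (F : Fin N × Fin N → ℝ) (hF : ∀ p, 0 ≤ F p) :
    ∑ e : Edge N, F e.1 ≤ ∑ p, F p := by
  have h := Finset.sum_map (Finset.univ : Finset (Edge N))
    (Function.Embedding.subtype fun e : Fin N × Fin N => e.1 < e.2) F
  simp only [Function.Embedding.subtype_apply] at h
  rw [← h]
  exact Finset.sum_le_sum_of_subset_of_nonneg (Finset.subset_univ _) fun p _ _ => hF p

theorem sum_sq_edge_mean_le (β : ℝ) (J : Edge N → ℝ) (hN : 0 < N) :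
    ∑ e : Edge N, (gibbsMean β J fun σ => edgeSpin σ e) ^ 2 ≤ (N : ℝ) ^ 2 * overlapSq β J := by
  have hN' : (N : ℝ) ≠ 0 := by exact_mod_cast hN.ne'
  rw [overlapSq, gibbsExp_siteOverlap_sq]
  rw [← mul_assoc, ← mul_pow, mul_one_div_cancel hN', one_pow, one_mul, ← Fintype.sum_prod_type']
  exact sum_edge_le_sum_pair
    (fun p => (gibbsMean β J fun σ => spin σ p.1 * spin σ p.2) ^ 2) fun _ => sq_nonneg _

theorem sum_sq_edge_pair_mean_le (β : ℝ) (J : Edge N → ℝ) (hN : 0 < N) :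
    ∑ e : Edge N, ∑ e' : Edge N, (gibbsMean β J fun σ => edgeSpin σ e * edgeSpin σ e') ^ 2
      ≤ (N : ℝ) ^ 4 * overlapSq β J := by
  have hN' : (N : ℝ) ≠ 0 := by exact_mod_cast hN.ne'
  let G : Fin N × Fin N → Fin N × Fin N → ℝ := fun p p' =>
    (gibbsMean β J fun σ => (spin σ p.1 * spin σ p.2) * (spin σ p'.1 * spin σ p'.2)) ^ 2
  have h1 : ∑ e : Edge N, ∑ e' : Edge N,
      (gibbsMean β J fun σ => edgeSpin σ e * edgeSpin σ e') ^ 2 ≤ ∑ p, ∑ p', G p p' :=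
    (Finset.sum_le_sum fun e _ => sum_edge_le_sum_pair (G e.1) fun _ => sq_nonneg _).trans
      (sum_edge_le_sum_pair (fun p => ∑ p', G p p') fun _ =>
        Finset.sum_nonneg fun _ _ => sq_nonneg _)
  have h2 : ∑ p, ∑ p', G p p' = (N : ℝ) ^ 4 *
      gibbsExp β J fun τ : Fin 2 → Config N => siteOverlap τ ^ 4 := by
    have h4 : ∀ τ : Fin 2 → Config N, siteOverlap τ ^ 4 = (1 / (N : ℝ)) ^ 4 *
        ∑ p : Fin N × Fin N, ∑ p' : Fin N × Fin N,
          ∏ l, ((spin (τ l) p.1 * spin (τ l) p.2) * (spin (τ l) p'.1 * spin (τ l) p'.2)) := by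
      intro τ
      have : siteOverlap τ ^ 4 = siteOverlap τ ^ 2 * siteOverlap τ ^ 2 := by ring
      rw [this, siteOverlap_sq, ← Fintype.sum_prod_type', mul_mul_mul_comm, Finset.sum_mul_sum]
      simp only [Finset.prod_mul_distrib]
      ring
    simp only [h4]
    rw [gibbsExp_const_mul, gibbsExp_sum, ← mul_assoc, ← mul_pow, mul_one_div_cancel hN', one_pow,
      one_mul]
    refine Finset.sum_congr rfl fun p _ => ?_
    rw [gibbsExp_sum]
    refine Finset.sum_congr rfl fun p' _ => ?_
    rw [gibbsExp_prod β J fun (_ : Fin 2) σ =>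
      (spin σ p.1 * spin σ p.2) * (spin σ p'.1 * spin σ p'.2)]
    simp [G]
  refine h1.trans (h2.trans_le (mul_le_mul_of_nonneg_left ?_ (by positivity)))
  refine gibbsExp_mono β J fun τ => ?_
  rw [← sq_abs, ← (by decide : Even 4).pow_abs]
  exact pow_le_pow_of_le_one (abs_nonneg _) (abs_siteOverlap_le τ) (by norm_num)

/-! ### Comparison of Gibbs means with and without given couplings -/

theorem abs_div_sub_le {u A B s r : ℝ} (hu : |u| ≤ 1) (hA : |A| ≤ s) (hB : |B| ≤ s)
    (hr : |r| ≤ 1) (h : r * (1 + B) = u + A) : |r - u| ≤ 4 * s := by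
  rcases le_total s (1 / 2) with hs | hs
  · have h1 : (r - u) * (1 + B) = A - u * B := by linear_combination h
    have h2 : |r - u| * |1 + B| ≤ 2 * s := by
      rw [← abs_mul, h1]
      calc |A - u * B| ≤ |A| + |u * B| := abs_sub _ _
        _ ≤ s + 1 * s := by
            rw [abs_mul]
            exact add_le_add hA (mul_le_mul hu hB (abs_nonneg _) zero_le_one)
        _ = 2 * s := by ring
    have h3 : 1 / 2 ≤ |1 + B| := by
      have := (abs_le.1 hB).1
      exact le_trans (by linarith) (le_abs_self _)
    nlinarith [abs_nonneg (r - u)]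
  · calc |r - u| ≤ |r| + |u| := abs_sub _ _
      _ ≤ 4 * s := by linarith

theorem abs_mul_le_of_abs_le_one {a b : ℝ} (ha : |a| ≤ 1) : |a * b| ≤ |b| := by
  rw [abs_mul]
  exact mul_le_of_le_one_left (abs_nonneg _) ha

theorem abs_gibbsMean_sub_update_le (β : ℝ) (J : Edge N → ℝ) (e : Edge N) {f : Config N → ℝ}
    (hf : ∀ σ, |f σ| ≤ 1) :
    |gibbsMean β J f - gibbsMean β (Function.update J e 0) f| ≤ 4 * |Real.tanh (β * J e)| := by
  refine abs_div_sub_le (abs_gibbsMean_le _ _ hf) ?_ ?_ (abs_gibbsMean_le _ _ hf)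
    (gibbsMean_mul_update β J e f)
  · rw [mul_comm]
    refine abs_mul_le_of_abs_le_one (abs_gibbsMean_le _ _ fun σ => ?_)
    rw [abs_mul, abs_edgeSpin, mul_one]
    exact hf σ
  · rw [mul_comm]
    exact abs_mul_le_of_abs_le_one (abs_gibbsMean_edgeSpin_le _ _ _)

/-- The couplings with those of two edges deleted. -/
def deletePair (J : Edge N → ℝ) (e e' : Edge N) : Edge N → ℝ :=
  Function.update (Function.update J e 0) e' 0

theorem abs_gibbsMean_deletePair_le (β : ℝ) (J : Edge N → ℝ) {e e' : Edge N} (hee : e' ≠ e)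
    {f : Config N → ℝ} (hf : ∀ σ, |f σ| ≤ 1) :
    |gibbsMean β (deletePair J e e') f| ≤ |gibbsMean β J f|
      + 4 * (|Real.tanh (β * J e)| + |Real.tanh (β * J e')|) := by
  have h1 := abs_gibbsMean_sub_update_le β J e hf
  have h2 := abs_gibbsMean_sub_update_le β (Function.update J e 0) e' hf
  rw [Function.update_of_ne hee] at h2
  have h3 := abs_sub_abs_le_abs_sub (gibbsMean β (deletePair J e e') f) (gibbsMean β J f)
  have h4 := abs_sub_le (gibbsMean β J f) (gibbsMean β (Function.update J e 0) f)
    (gibbsMean β (deletePair J e e') f)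
  rw [abs_sub_comm] at h3
  unfold deletePair at *
  linarith

/-- The total size of the correlations of two edges in the absence of their couplings. -/
def pairError (β : ℝ) (J : Edge N → ℝ) (e e' : Edge N) : ℝ :=
  |gibbsMean β (deletePair J e e') fun σ => edgeSpin σ e|
    + |gibbsMean β (deletePair J e e') fun σ => edgeSpin σ e'|
    + |gibbsMean β (deletePair J e e') fun σ => edgeSpin σ e * edgeSpin σ e'|

theorem gibbsMean_mul_deletePair (β : ℝ) (J : Edge N → ℝ) {e e' : Edge N} (hee : e' ≠ e)
    (f : Config N → ℝ) :
    gibbsMean β J f * (1 + (Real.tanh (β * J e') *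
        (gibbsMean β (deletePair J e e') fun σ => edgeSpin σ e') + Real.tanh (β * J e) *
        ((gibbsMean β (deletePair J e e') fun σ => edgeSpin σ e) + Real.tanh (β * J e') *
          gibbsMean β (deletePair J e e') fun σ => edgeSpin σ e * edgeSpin σ e')))
      = gibbsMean β (deletePair J e e') f
        + Real.tanh (β * J e') * (gibbsMean β (deletePair J e e') fun σ => f σ * edgeSpin σ e')
        + Real.tanh (β * J e) * ((gibbsMean β (deletePair J e e') fun σ => f σ * edgeSpin σ e)
          + Real.tanh (β * J e') *
            gibbsMean β (deletePair J e e') fun σ => f σ * edgeSpin σ e * edgeSpin σ e') := by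
  have h0 := gibbsMean_mul_update β J e f
  have h1 := gibbsMean_mul_update β (Function.update J e 0) e' f
  have h2 := gibbsMean_mul_update β (Function.update J e 0) e' fun σ => edgeSpin σ e
  have h3 := gibbsMean_mul_update β (Function.update J e 0) e' fun σ => f σ * edgeSpin σ e
  rw [Function.update_of_ne hee] at h1 h2 h3
  unfold deletePair
  set D := 1 + Real.tanh (β * J e') * gibbsMean β
    (Function.update (Function.update J e 0) e' 0) fun σ => edgeSpin σ e' with hD
  linear_combination D * h0 + h1 + Real.tanh (β * J e) * h3
    - gibbsMean β J f * Real.tanh (β * J e) * h2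

theorem abs_le_of_sum_three {t t' a b d s : ℝ} (ht : |t| ≤ 1) (ht' : |t'| ≤ 1)
    (hs : |a| + |b| + |d| ≤ s) : |t' * b + t * (a + t' * d)| ≤ s := by
  have h1 : |t' * b| ≤ |b| := abs_mul_le_of_abs_le_one ht'
  have h2 : |t * (a + t' * d)| ≤ |a + t' * d| := abs_mul_le_of_abs_le_one ht
  have h3 : |a + t' * d| ≤ |a| + |t' * d| := abs_add_le _ _
  have h4 : |t' * d| ≤ |d| := abs_mul_le_of_abs_le_one ht'
  have h5 := abs_add_le (t' * b) (t * (a + t' * d))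
  linarith

theorem abs_add_three_mul_le {t t' x y z : ℝ} (ht : |t| ≤ 1) (ht' : |t'| ≤ 1) :
    |x + t * y + t' * z| ≤ |x| + |y| + |z| :=
  (abs_add_three _ _ _).trans (add_le_add (add_le_add le_rfl (abs_mul_le_of_abs_le_one ht))
    (abs_mul_le_of_abs_le_one ht'))

theorem pairError_bounds (β : ℝ) (J : Edge N → ℝ) {e e' : Edge N} (hee : e' ≠ e) :
    |(gibbsMean β J fun σ => edgeSpin σ e) - Real.tanh (β * J e)| ≤ 4 * pairError β J e e' ∧
    |(gibbsMean β J fun σ => edgeSpin σ e') - Real.tanh (β * J e')| ≤ 4 * pairError β J e e' ∧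
    |(gibbsMean β J fun σ => edgeSpin σ e * edgeSpin σ e')
      - Real.tanh (β * J e) * Real.tanh (β * J e')| ≤ 4 * pairError β J e e' := by
  have ht := (Real.abs_tanh_lt_one (β * J e)).le
  have ht' := (Real.abs_tanh_lt_one (β * J e')).le
  have htt : |Real.tanh (β * J e) * Real.tanh (β * J e')| ≤ 1 :=
    (abs_mul_le_of_abs_le_one ht).trans ht'
  have hone : (gibbsMean β (deletePair J e e') fun _ => (1 : ℝ)) = 1 := by
    simp [gibbsMean, sum_gibbsWeight]
  have hone' : (gibbsMean β J fun _ => (1 : ℝ)) = 1 := by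
    simp [gibbsMean, sum_gibbsWeight]
  have hsq : ∀ σ : Config N, edgeSpin σ e' * edgeSpin σ e * edgeSpin σ e' = edgeSpin σ e :=
    fun σ => by rw [mul_right_comm, edgeSpin_mul_self, one_mul]
  have hsq₁ : ∀ σ : Config N, edgeSpin σ e * edgeSpin σ e' * edgeSpin σ e = edgeSpin σ e' :=
    fun σ => by rw [mul_right_comm, edgeSpin_mul_self, one_mul]
  have hsq₂ : ∀ σ : Config N, edgeSpin σ e * edgeSpin σ e' * edgeSpin σ e' = edgeSpin σ e :=
    fun σ => by rw [mul_assoc, edgeSpin_mul_self, mul_one]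
  have hcomm : ∀ σ : Config N, edgeSpin σ e' * edgeSpin σ e = edgeSpin σ e * edgeSpin σ e' :=
    fun σ => mul_comm _ _
  have h1 := gibbsMean_mul_deletePair β J hee fun σ => edgeSpin σ e
  have h2 := gibbsMean_mul_deletePair β J hee fun σ => edgeSpin σ e'
  have h3 := gibbsMean_mul_deletePair β J hee fun σ => edgeSpin σ e * edgeSpin σ e'
  simp only [hsq, hsq₁, hsq₂, edgeSpin_mul_self, hone, one_mul] at h1 h2 h3
  simp only [hcomm] at h2
  have hB := abs_le_of_sum_three ht ht'
    (le_refl (pairError β J e e'))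
  unfold pairError at *
  set a := gibbsMean β (deletePair J e e') fun σ => edgeSpin σ e
  set b := gibbsMean β (deletePair J e e') fun σ => edgeSpin σ e'
  set d := gibbsMean β (deletePair J e e') fun σ => edgeSpin σ e * edgeSpin σ e'
  set t := Real.tanh (β * J e)
  set t' := Real.tanh (β * J e')
  refine ⟨abs_div_sub_le (A := a + t' * d + (t * t') * b) ht ?_ hB
      (abs_gibbsMean_edgeSpin_le _ _ _) (h1.trans (by ring)),
    abs_div_sub_le (A := b + t * d + (t * t') * a) ht' ?_ hB
      (abs_gibbsMean_edgeSpin_le _ _ _) (h2.trans (by ring)),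
    abs_div_sub_le (A := d + t' * a + t * b) htt ?_ hB
      (abs_gibbsMean_edgeSpin_mul_le _ _ _ _) (h3.trans (by ring))⟩
  · have := abs_add_three_mul_le (x := a) (y := d) (z := b) ht' htt
    linarith
  · have := abs_add_three_mul_le (x := b) (y := d) (z := a) ht htt
    linarith
  · have := abs_add_three_mul_le (x := d) (y := a) (z := b) ht' ht
    linarith

theorem pairError_nonneg (β : ℝ) (J : Edge N → ℝ) (e e' : Edge N) : 0 ≤ pairError β J e e' := by
  unfold pairError; positivity

theorem abs_sq_sub_sq_le {x y s : ℝ} (hx : |x| ≤ 1) (hy : |y| ≤ 1) (h : |x - y| ≤ s) :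
    |x ^ 2 - y ^ 2| ≤ 2 * s := by
  have : x ^ 2 - y ^ 2 = (x + y) * (x - y) := by ring
  rw [this, abs_mul]
  exact mul_le_mul ((abs_add_le x y).trans (by linarith)) h (abs_nonneg _) (by norm_num)

/-- The replica covariance of two edges compared with its decoupled value. -/
theorem abs_pair_covariance_sub_le (β q : ℝ) (J : Edge N → ℝ) {e e' : Edge N} (hee : e' ≠ e) :
    |(gibbsMean β J fun σ => edgeSpin σ e * edgeSpin σ e') ^ 2
        - q * (gibbsMean β J fun σ => edgeSpin σ e) ^ 2
        - q * (gibbsMean β J fun σ => edgeSpin σ e') ^ 2 + q ^ 2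
      - (Real.tanh (β * J e) ^ 2 - q) * (Real.tanh (β * J e') ^ 2 - q)|
      ≤ 8 * (1 + 2 * |q|) * pairError β J e e' := by
  have ht := (Real.abs_tanh_lt_one (β * J e)).le
  have ht' := (Real.abs_tanh_lt_one (β * J e')).le
  have htt : |Real.tanh (β * J e) * Real.tanh (β * J e')| ≤ 1 :=
    (abs_mul_le_of_abs_le_one ht).trans ht'
  obtain ⟨h1, h2, h3⟩ := pairError_bounds β J hee
  have k1 := abs_sq_sub_sq_le (abs_gibbsMean_edgeSpin_le _ _ _) ht h1
  have k2 := abs_sq_sub_sq_le (abs_gibbsMean_edgeSpin_le _ _ _) ht' h2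
  have k3 := abs_sq_sub_sq_le (abs_gibbsMean_edgeSpin_mul_le _ _ _ _) htt h3
  set x := gibbsMean β J fun σ => edgeSpin σ e
  set y := gibbsMean β J fun σ => edgeSpin σ e'
  set z := gibbsMean β J fun σ => edgeSpin σ e * edgeSpin σ e'
  set t := Real.tanh (β * J e)
  set t' := Real.tanh (β * J e')
  have : z ^ 2 - q * x ^ 2 - q * y ^ 2 + q ^ 2 - (t ^ 2 - q) * (t' ^ 2 - q)
      = (z ^ 2 - (t * t') ^ 2) - q * (x ^ 2 - t ^ 2) - q * (y ^ 2 - t' ^ 2) := by ring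
  rw [this]
  have l1 := abs_sub (z ^ 2 - (t * t') ^ 2 - q * (x ^ 2 - t ^ 2)) (q * (y ^ 2 - t' ^ 2))
  have l2 := abs_sub (z ^ 2 - (t * t') ^ 2) (q * (x ^ 2 - t ^ 2))
  rw [abs_mul q] at l1 l2
  have m1 := mul_le_mul_of_nonneg_left k1 (abs_nonneg q)
  have m2 := mul_le_mul_of_nonneg_left k2 (abs_nonneg q)
  linarith

theorem abs_le_add_sq_div {x ε : ℝ} (hε : 0 < ε) : |x| ≤ ε + x ^ 2 / ε := by
  rw [← sq_abs, ← sub_nonneg]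
  have : ε + |x| ^ 2 / ε - |x| = ((ε - |x|) ^ 2 + ε * |x|) / ε := by field_simp; ring
  rw [this]
  positivity

theorem pairError_le (β : ℝ) (J : Edge N → ℝ) {e e' : Edge N} (hee : e' ≠ e) {ε : ℝ}
    (hε : 0 < ε) :
    pairError β J e e' ≤ 27 * ε + ((gibbsMean β J fun σ => edgeSpin σ e) ^ 2
      + (gibbsMean β J fun σ => edgeSpin σ e') ^ 2
      + (gibbsMean β J fun σ => edgeSpin σ e * edgeSpin σ e') ^ 2
      + 12 * Real.tanh (β * J e) ^ 2 + 12 * Real.tanh (β * J e') ^ 2) / ε := by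
  have h1 := abs_gibbsMean_deletePair_le β J hee fun σ => (abs_edgeSpin σ e).le
  have h2 := abs_gibbsMean_deletePair_le β J hee fun σ => (abs_edgeSpin σ e').le
  have h3 := abs_gibbsMean_deletePair_le β J hee (f := fun σ => edgeSpin σ e * edgeSpin σ e')
    fun σ => by simp [abs_mul, abs_edgeSpin]
  have k1 := abs_le_add_sq_div (x := gibbsMean β J fun σ => edgeSpin σ e) hε
  have k2 := abs_le_add_sq_div (x := gibbsMean β J fun σ => edgeSpin σ e') hε
  have k3 := abs_le_add_sq_div (x := gibbsMean β J fun σ => edgeSpin σ e * edgeSpin σ e') hε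
  have k4 := abs_le_add_sq_div (x := Real.tanh (β * J e)) hε
  have k5 := abs_le_add_sq_div (x := Real.tanh (β * J e')) hε
  unfold pairError
  rw [add_div, add_div, add_div, add_div, mul_div_assoc, mul_div_assoc]
  linarith

end Deterministic

/-! ### The law of one coupling -/

theorem integrable_comp_abs {f : ℝ → ℝ} (hf : IntegrableOn f (Set.Ioi 0)) :
    Integrable fun x => f |x| := by
  have h1 : IntegrableOn (fun x => f |x|) (Set.Ioi 0) :=
    hf.congr_fun (fun x hx => by rw [abs_of_pos hx]) measurableSet_Ioi
  have h2 : IntegrableOn (fun x => f |x|) (Set.Iic 0) := by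
    rw [← Measure.map_neg_eq_self (volume : Measure ℝ)]
    let m : MeasurableEmbedding fun x : ℝ => -x := (Homeomorph.neg ℝ).measurableEmbedding
    rw [m.integrableOn_map_iff]
    simp_rw [Function.comp_def, abs_neg, Set.neg_preimage, Set.neg_Iic, neg_zero]
    exact Iff.mpr integrableOn_Ici_iff_integrableOn_Ioi h1
  rw [← integrableOn_univ, ← Set.Iic_union_Ioi (a := (0 : ℝ))]
  exact h2.union h1

/-- The Lebesgue density of the disorder law as a function of the modulus. -/
def disorderDensity (α : ℝ) (N : ℕ) (y : ℝ) : ℝ :=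
  if (N : ℝ) ^ (-1 / α) ≤ y then α / (2 * N) * (1 / y ^ (α + 1)) else 0

theorem disorderLaw_eq (α : ℝ) (N : ℕ) :
    disorderLaw α N = volume.withDensity fun x => ENNReal.ofReal (disorderDensity α N |x|) := rfl

theorem measurable_disorderDensity (α : ℝ) (N : ℕ) : Measurable (disorderDensity α N) :=
  Measurable.ite measurableSet_Ici (by fun_prop) measurable_const

theorem disorderDensity_nonneg {α : ℝ} (hα : 0 < α) (N : ℕ) {y : ℝ} (hy : 0 ≤ y) :
    0 ≤ disorderDensity α N y := by
  unfold disorderDensity; split_ifs <;> positivity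

theorem measurePreserving_neg_disorderLaw (α : ℝ) (N : ℕ) :
    MeasurePreserving (fun x : ℝ => -x) (disorderLaw α N) (disorderLaw α N) := by
  refine ⟨measurable_neg, ?_⟩
  ext s hs
  have hd : Measurable fun x : ℝ => ENNReal.ofReal (disorderDensity α N |x|) :=
    ((measurable_disorderDensity α N).comp measurable_id.abs).ennreal_ofReal
  rw [Measure.map_apply measurable_neg hs, disorderLaw_eq,
    withDensity_apply _ (measurable_neg hs), withDensity_apply _ hs,
    ← (Measure.measurePreserving_neg (volume : Measure ℝ)).setLIntegral_comp_preimage hs hd]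
  simp

theorem integral_disorderLaw_comp_abs {α : ℝ} (hα : 0 < α) {N : ℕ} (hN : 0 < N) (f : ℝ → ℝ) :
    ∫ x, f |x| ∂(disorderLaw α N)
      = α / N * ∫ x in Set.Ioi ((N : ℝ) ^ (-1 / α)), f x / x ^ (α + 1) := by
  have hN' : (0 : ℝ) < N := by exact_mod_cast hN
  have ha : 0 < (N : ℝ) ^ (-1 / α) := Real.rpow_pos_of_pos hN' _
  have hd : Measurable fun x : ℝ => ENNReal.ofReal (disorderDensity α N |x|) :=
    ((measurable_disorderDensity α N).comp measurable_id.abs).ennreal_ofReal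
  rw [disorderLaw_eq, integral_withDensity_eq_integral_toReal_smul hd (by simp)]
  simp only [ENNReal.toReal_ofReal (disorderDensity_nonneg hα N (abs_nonneg _)), smul_eq_mul]
  rw [integral_comp_abs (f := fun y => disorderDensity α N y * f y)]
  have h1 : ∫ x in Set.Ioi (0 : ℝ), disorderDensity α N x * f x
      = ∫ x in Set.Ioi (0 : ℝ), (Set.Ici ((N : ℝ) ^ (-1 / α))).indicator
        (fun x => α / (2 * N) * (f x / x ^ (α + 1))) x := by
    refine integral_congr_ae (Eventually.of_forall fun x => ?_)
    simp only [disorderDensity, Set.indicator, Set.mem_Ici]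
    split_ifs
    · ring
    · ring
  rw [h1, setIntegral_indicator measurableSet_Ici,
    Set.inter_eq_right.2 (show Set.Ici ((N : ℝ) ^ (-1 / α)) ⊆ Set.Ioi 0 from
      fun x hx => lt_of_lt_of_le ha hx),
    integral_Ici_eq_integral_Ioi, integral_const_mul]
  field_simp

theorem integrable_disorderLaw_comp_abs {α : ℝ} (hα : 0 < α) {N : ℕ} (hN : 0 < N) {f : ℝ → ℝ}
    (hf : IntegrableOn (fun x => f x / x ^ (α + 1)) (Set.Ioi ((N : ℝ) ^ (-1 / α)))) :
    Integrable (fun x => f |x|) (disorderLaw α N) := by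
  have hN' : (0 : ℝ) < N := by exact_mod_cast hN
  have ha : 0 < (N : ℝ) ^ (-1 / α) := Real.rpow_pos_of_pos hN' _
  have hd : Measurable fun x : ℝ => ENNReal.ofReal (disorderDensity α N |x|) :=
    ((measurable_disorderDensity α N).comp measurable_id.abs).ennreal_ofReal
  rw [disorderLaw_eq, integrable_withDensity_iff_integrable_smul' hd (by simp)]
  simp only [ENNReal.toReal_ofReal (disorderDensity_nonneg hα N (abs_nonneg _)), smul_eq_mul]
  refine integrable_comp_abs (f := fun y => disorderDensity α N y * f y) ?_
  have h1 : (fun x => disorderDensity α N x * f x) = (Set.Ici ((N : ℝ) ^ (-1 / α))).indicator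
        (fun x => α / (2 * N) * (f x / x ^ (α + 1))) := by
    funext x
    simp only [disorderDensity, Set.indicator, Set.mem_Ici]
    split_ifs
    · ring
    · ring
  rw [h1]
  have h2 : IntegrableOn (fun x => f x / x ^ (α + 1)) (Set.Ici ((N : ℝ) ^ (-1 / α))) :=
    Iff.mpr integrableOn_Ici_iff_integrableOn_Ioi hf
  exact ((integrable_indicator_iff measurableSet_Ici).2 (h2.const_mul _)).integrableOn

theorem integrableOn_div_rpow {α : ℝ} (hα₁ : 1 < α) (hα₂ : α < 2) {h : ℝ → ℝ}
    (hm : Measurable h) {C : ℝ} (h1 : ∀ x, 0 < x → |h x| ≤ C * x)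
    (h2 : ∀ x, 0 < x → |h x| ≤ C * x ^ 2) :
    IntegrableOn (fun x => h x / x ^ (α + 1)) (Set.Ioi 0) := by
  have hm' : Measurable fun x => h x / x ^ (α + 1) := by fun_prop
  rw [← Set.Ioc_union_Ioi_eq_Ioi (zero_le_one' ℝ)]
  refine IntegrableOn.union ?_ ?_
  · have hi : IntegrableOn (fun x : ℝ => C * x ^ (1 - α)) (Set.Ioc 0 1) := by
      have := (intervalIntegral.intervalIntegrable_rpow' (a := 0) (b := 1) (r := 1 - α)
        (by linarith)).const_mul C
      exact (intervalIntegrable_iff_integrableOn_Ioc_of_le zero_le_one).1 this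
    refine hi.mono' hm'.aestronglyMeasurable ?_
    refine (ae_restrict_iff' measurableSet_Ioc).2 (Eventually.of_forall fun x hx => ?_)
    have hx0 : 0 < x := hx.1
    have hp : 0 < x ^ (α + 1) := Real.rpow_pos_of_pos hx0 _
    rw [Real.norm_eq_abs, abs_div, abs_of_pos hp, div_le_iff₀ hp, mul_assoc,
      ← Real.rpow_add hx0]
    have : 1 - α + (α + 1) = (2 : ℕ) := by push_cast; ring
    rw [this, Real.rpow_natCast]
    exact h2 x hx0
  · have hi : IntegrableOn (fun x : ℝ => C * x ^ (-α)) (Set.Ioi 1) :=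
      (integrableOn_Ioi_rpow_of_lt (by linarith) one_pos).const_mul C
    refine hi.mono' hm'.aestronglyMeasurable ?_
    refine (ae_restrict_iff' measurableSet_Ioi).2 (Eventually.of_forall fun x hx => ?_)
    have hx0 : 0 < x := lt_trans one_pos hx
    have hp : 0 < x ^ (α + 1) := Real.rpow_pos_of_pos hx0 _
    rw [Real.norm_eq_abs, abs_div, abs_of_pos hp, div_le_iff₀ hp, mul_assoc,
      ← Real.rpow_add hx0]
    have : -α + (α + 1) = 1 := by ring
    rw [this, Real.rpow_one]
    exact h1 x hx0

theorem integrableOn_tanh_sq_div {α : ℝ} (hα₁ : 1 < α) (hα₂ : α < 2) {b : ℝ} (hb : 0 ≤ b) :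
    IntegrableOn (fun x => Real.tanh (b * x) ^ 2 / x ^ (α + 1)) (Set.Ioi 0) := by
  have hm : Measurable fun x => Real.tanh (b * x) ^ 2 := by
    have := measurable_tanh; fun_prop
  refine integrableOn_div_rpow hα₁ hα₂ hm (C := b + b ^ 2) (fun x hx => ?_) fun x hx => ?_
  · have h0 := tanh_nonneg (mul_nonneg hb hx.le)
    have h1 := (Real.tanh_lt_one (b * x)).le
    have h2 := tanh_le_self (mul_nonneg hb hx.le)
    rw [abs_of_nonneg (by positivity)]
    nlinarith [mul_nonneg (sq_nonneg b) hx.le]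
  · have h0 := tanh_nonneg (mul_nonneg hb hx.le)
    have h2 := tanh_le_self (mul_nonneg hb hx.le)
    rw [abs_of_nonneg (by positivity)]
    nlinarith [mul_nonneg hb (sq_nonneg x), pow_le_pow_left₀ h0 h2 2]

theorem integrableOn_mul_tanh_div {α : ℝ} (hα₁ : 1 < α) (hα₂ : α < 2) {b : ℝ} (hb : 0 ≤ b) :
    IntegrableOn (fun x => x * Real.tanh (b * x) / x ^ (α + 1)) (Set.Ioi 0) := by
  have hm : Measurable fun x => x * Real.tanh (b * x) := by
    have := measurable_tanh; fun_prop
  refine integrableOn_div_rpow hα₁ hα₂ hm (C := 1 + b) (fun x hx => ?_) fun x hx => ?_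
  · have h0 := tanh_nonneg (mul_nonneg hb hx.le)
    have h1 := (Real.tanh_lt_one (b * x)).le
    rw [abs_of_nonneg (by positivity)]
    nlinarith [mul_nonneg hb hx.le]
  · have h0 := tanh_nonneg (mul_nonneg hb hx.le)
    have h2 := tanh_le_self (mul_nonneg hb hx.le)
    rw [abs_of_nonneg (by positivity)]
    nlinarith [sq_nonneg x]

theorem integral_disorderLaw_le {α : ℝ} (hα : 0 < α) {N : ℕ} (hN : 0 < N) {f : ℝ → ℝ}
    (hf : IntegrableOn (fun x => f x / x ^ (α + 1)) (Set.Ioi 0)) (h0 : ∀ x, 0 < x → 0 ≤ f x) :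
    ∫ x, f |x| ∂(disorderLaw α N) ≤ (α * ∫ x in Set.Ioi 0, f x / x ^ (α + 1)) / N := by
  have hN' : (0 : ℝ) < N := by exact_mod_cast hN
  have ha : 0 < (N : ℝ) ^ (-1 / α) := Real.rpow_pos_of_pos hN' _
  rw [integral_disorderLaw_comp_abs hα hN, mul_div_right_comm]
  refine mul_le_mul_of_nonneg_left ?_ (by positivity)
  refine setIntegral_mono_set hf ?_ (Eventually.of_forall (Set.Ioi_subset_Ioi ha.le))
  refine (ae_restrict_iff' measurableSet_Ioi).2 (Eventually.of_forall fun x hx => ?_)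
  have hx0 : 0 < x := hx
  exact div_nonneg (h0 x hx0) (by positivity)

theorem integrable_abs_disorderLaw {α : ℝ} (hα₁ : 1 < α) (hα₂ : α < 2) {N : ℕ} (hN : 0 < N) :
    Integrable (fun x : ℝ => |x|) (disorderLaw α N) := by
  have hN' : (0 : ℝ) < N := by exact_mod_cast hN
  have ha : 0 < (N : ℝ) ^ (-1 / α) := Real.rpow_pos_of_pos hN' _
  refine integrable_disorderLaw_comp_abs (by linarith) hN (f := fun x => x) ?_
  refine (integrableOn_Ioi_rpow_of_lt (a := -α) (by linarith) ha).congr_fun (fun x hx => ?_)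
    measurableSet_Ioi
  have hx0 : 0 < x := ha.trans hx
  have : -α = 1 - (α + 1) := by ring
  simp only
  rw [this, Real.rpow_sub hx0, Real.rpow_one]

/-- The constant `c` in the bound `E tanh²(βJ) ≤ c / N`. -/
def tanhConst (α β : ℝ) : ℝ := α * ∫ x in Set.Ioi 0, Real.tanh (β * x) ^ 2 / x ^ (α + 1)

/-- The constant `B` in the bound `E |J tanh(βJ)| ≤ B / N`. -/
def driftConst (α β : ℝ) : ℝ := α * ∫ x in Set.Ioi 0, x * Real.tanh (β * x) / x ^ (α + 1)

theorem tanhConst_nonneg {α : ℝ} (hα : 0 < α) (β : ℝ) : 0 ≤ tanhConst α β := by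
  refine mul_nonneg hα.le (setIntegral_nonneg measurableSet_Ioi fun x hx => ?_)
  have hx0 : 0 < x := hx
  positivity

theorem driftConst_nonneg {α : ℝ} (hα : 0 < α) {β : ℝ} (hβ : 0 ≤ β) : 0 ≤ driftConst α β := by
  refine mul_nonneg hα.le (setIntegral_nonneg measurableSet_Ioi fun x hx => ?_)
  have hx0 : 0 < x := hx
  exact div_nonneg (mul_nonneg hx0.le (tanh_nonneg (by positivity))) (by positivity)

theorem tanhConst_eq {α β : ℝ} (hβ : 0 < β) :
    tanhConst α β = β ^ α * (α * ∫ x in Set.Ioi 0, Real.tanh x ^ 2 / x ^ (α + 1)) := by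
  have h := integral_comp_mul_left_Ioi (fun x => Real.tanh x ^ 2 / x ^ (α + 1)) 0 hβ
  rw [mul_zero, smul_eq_mul] at h
  have h2 : ∫ x in Set.Ioi 0, Real.tanh (β * x) ^ 2 / (β * x) ^ (α + 1)
      = (β ^ (α + 1))⁻¹ * ∫ x in Set.Ioi 0, Real.tanh (β * x) ^ 2 / x ^ (α + 1) := by
    rw [← integral_const_mul]
    refine setIntegral_congr_fun measurableSet_Ioi fun x hx => ?_
    have hx0 : 0 < x := hx
    rw [Real.mul_rpow hβ.le hx0.le]
    field_simp
  rw [h2] at h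
  have hp : 0 < β ^ α := Real.rpow_pos_of_pos hβ _
  rw [Real.rpow_add hβ, Real.rpow_one] at h
  unfold tanhConst
  field_simp at h
  rw [h]
  ring

theorem tanhConst_lt_one {α β : ℝ} (hα₁ : 1 < α) (hβ₀ : 0 < β) (hβ : β < criticalBeta α) :
    tanhConst α β < 1 := by
  have hα : 0 < α := by linarith
  rw [tanhConst_eq hβ₀]
  unfold criticalBeta at hβ
  have hA : 0 ≤ α * ∫ x in Set.Ioi (0 : ℝ), Real.tanh x ^ 2 / x ^ (α + 1) := by
    refine mul_nonneg hα.le (setIntegral_nonneg measurableSet_Ioi fun x hx => ?_)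
    have hx0 : 0 < x := hx
    positivity
  set A := α * ∫ x in Set.Ioi (0 : ℝ), Real.tanh x ^ 2 / x ^ (α + 1)
  rcases hA.eq_or_lt with h0 | h0
  · rw [← h0]; simp
  · have h1 := Real.rpow_lt_rpow hβ₀.le hβ hα
    rw [← Real.rpow_mul h0.le, div_mul_cancel₀ _ hα.ne', Real.rpow_neg_one] at h1
    calc β ^ α * A < A⁻¹ * A := mul_lt_mul_of_pos_right h1 h0
      _ = 1 := inv_mul_cancel₀ h0.ne'

theorem integral_tanh_sq_le {α β : ℝ} (hα₁ : 1 < α) (hα₂ : α < 2) (hβ : 0 ≤ β) {N : ℕ}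
    (hN : 0 < N) :
    ∫ x, Real.tanh (β * x) ^ 2 ∂(disorderLaw α N) ≤ tanhConst α β / N := by
  have h := integral_disorderLaw_le (by linarith) hN (integrableOn_tanh_sq_div hα₁ hα₂ hβ)
    fun x _ => sq_nonneg _
  refine le_trans (le_of_eq ?_) h
  congr 1
  funext x
  rw [← abs_of_nonneg hβ, ← abs_mul, tanh_abs, sq_abs, abs_of_nonneg hβ]

theorem integral_abs_mul_tanh_le {α β : ℝ} (hα₁ : 1 < α) (hα₂ : α < 2) (hβ : 0 ≤ β) {N : ℕ}
    (hN : 0 < N) :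
    ∫ x, |x * Real.tanh (β * x)| ∂(disorderLaw α N) ≤ driftConst α β / N := by
  have h := integral_disorderLaw_le (by linarith) hN (integrableOn_mul_tanh_div hα₁ hα₂ hβ)
    fun x hx => mul_nonneg hx.le (tanh_nonneg (mul_nonneg hβ hx.le))
  refine le_trans (le_of_eq ?_) h
  congr 1
  funext x
  rw [abs_mul, ← tanh_abs, abs_mul, abs_of_nonneg hβ]

theorem integral_odd_disorderLaw {α : ℝ} (N : ℕ) {f : ℝ → ℝ} (hf : ∀ x, f (-x) = -f x) :
    ∫ x, f x ∂(disorderLaw α N) = 0 := by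
  have h := (measurePreserving_neg_disorderLaw α N).integral_comp
    (Homeomorph.neg ℝ).measurableEmbedding f
  simp only [hf, integral_neg] at h
  linarith

theorem integral_heavy {α : ℝ} (hα : 0 < α) {N : ℕ} (hN : 0 < N) {K : ℝ}
    (hK : (N : ℝ) ^ (-1 / α) ≤ K) (f : ℝ → ℝ) :
    ∫ x, (Set.Ici K).indicator f |x| ∂(disorderLaw α N)
      = α / N * ∫ x in Set.Ioi K, f x / x ^ (α + 1) := by
  rw [integral_disorderLaw_comp_abs hα hN]
  have h1 : (fun x => (Set.Ici K).indicator f x / x ^ (α + 1))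
      = (Set.Ici K).indicator fun x => f x / x ^ (α + 1) := by
    funext x
    simp only [Set.indicator]
    split_ifs <;> simp
  rw [h1, ← integral_Ici_eq_integral_Ioi, setIntegral_indicator measurableSet_Ici,
    Set.Ici_inter_Ici, sup_eq_right.2 hK, integral_Ici_eq_integral_Ioi]

theorem integral_heavy_one {α : ℝ} (hα : 0 < α) {N : ℕ} (hN : 0 < N) {K : ℝ}
    (hK : (N : ℝ) ^ (-1 / α) ≤ K) :
    ∫ x, (Set.Ici K).indicator (fun _ => (1 : ℝ)) |x| ∂(disorderLaw α N) = K ^ (-α) / N := by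
  have hN' : (0 : ℝ) < N := by exact_mod_cast hN
  have hK0 : 0 < K := (Real.rpow_pos_of_pos hN' _).trans_le hK
  rw [integral_heavy hα hN hK]
  have : ∫ x in Set.Ioi K, 1 / x ^ (α + 1) = ∫ x in Set.Ioi K, x ^ (-(α + 1)) :=
    setIntegral_congr_fun measurableSet_Ioi fun x hx => by
      have hx0 : 0 < x := hK0.trans hx
      rw [Real.rpow_neg hx0.le, one_div]
  rw [this, integral_Ioi_rpow_of_lt (by linarith) hK0]
  have h2 : -(α + 1) + 1 = -α := by ring
  rw [h2]
  field_simp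

theorem integral_heavy_tanh_sq {α : ℝ} (hα : 0 < α) (β : ℝ) {N : ℕ}
    (hN : 0 < N) {K : ℝ} (hK : (N : ℝ) ^ (-1 / α) ≤ K) :
    ∫ x, (Set.Ici K).indicator (fun y => Real.tanh (β * y) ^ 2) |x| ∂(disorderLaw α N)
      = K ^ (-α) / N * bondLimit α β K := by
  have hN' : (0 : ℝ) < N := by exact_mod_cast hN
  have hK0 : 0 < K := (Real.rpow_pos_of_pos hN' _).trans_le hK
  have hKα : K ^ (-α) * K ^ α = 1 := by
    rw [← Real.rpow_add hK0, neg_add_cancel, Real.rpow_zero]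
  rw [integral_heavy hα hN hK, bondLimit, add_comm 1 α]
  linear_combination (-α / N * ∫ x in Set.Ioi K, Real.tanh (β * x) ^ 2 / x ^ (α + 1)) * hKα

theorem bondLimit_pos {α β : ℝ} (hα₁ : 1 < α) (hα₂ : α < 2) (hβ : 0 < β) {K : ℝ} (hK : 0 < K) :
    0 < bondLimit α β K := by
  unfold bondLimit
  refine mul_pos (mul_pos (by linarith) (Real.rpow_pos_of_pos hK _)) ?_
  rw [add_comm 1 α]
  have hpos : ∀ x ∈ Set.Ioi K, 0 < Real.tanh (β * x) ^ 2 / x ^ (α + 1) := fun x hx => by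
    have hx0 : 0 < x := hK.trans hx
    have := tanh_pos (mul_pos hβ hx0)
    positivity
  rw [setIntegral_pos_iff_support_of_nonneg_ae]
  · refine lt_of_lt_of_le ?_ (measure_mono (Set.subset_inter (fun x hx => (hpos x hx).ne') le_rfl))
    simp
  · exact (ae_restrict_iff' measurableSet_Ioi).2 (Eventually.of_forall fun x hx => (hpos x hx).le)
  · exact (integrableOn_tanh_sq_div hα₁ hα₂ hβ.le).mono_set (Set.Ioi_subset_Ioi hK.le)

/-! ### The reduced partition function -/

section Reduced

variable {N : ℕ}

/-- The logarithm of the reduced partition function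
`2⁻ᴺ ∑_σ ∏_e (1 + tanh(b J_e) σ_e)`. -/
def logReduced (b : ℝ) (J : Edge N → ℝ) : ℝ :=
  Real.log (partitionFunction b J) - N * Real.log 2 - ∑ e, Real.log (Real.cosh (b * J e))

theorem exp_logReduced (b : ℝ) (J : Edge N → ℝ) :
    Real.exp (logReduced b J)
      = partitionFunction b J / 2 ^ N / ∏ e, Real.cosh (b * J e) := by
  rw [logReduced, Real.exp_sub, Real.exp_sub, Real.exp_log (partitionFunction_pos b J),
    Real.exp_nat_mul, Real.exp_log two_pos, Real.exp_sum]
  simp only [Real.exp_log (Real.cosh_pos _)]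

theorem exp_negHamiltonian (b : ℝ) (J : Edge N → ℝ) (σ : Config N) :
    Real.exp (negHamiltonian b J σ)
      = (∏ e, Real.cosh (b * J e)) * ∏ e, (1 + Real.tanh (b * J e) * edgeSpin σ e) := by
  rw [negHamiltonian_eq, Finset.mul_sum, Real.exp_sum, ← Finset.prod_mul_distrib]
  refine Finset.prod_congr rfl fun e _ => ?_
  rw [← mul_assoc, exp_mul_sign _ _ (edgeSpin_eq σ e)]

theorem gibbsWeight_mul_exp_logReduced (b : ℝ) (J : Edge N → ℝ) (σ : Config N) :
    Real.exp (logReduced b J) * gibbsWeight b J σ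
      = (1 / 2 ^ N) * ∏ e, (1 + Real.tanh (b * J e) * edgeSpin σ e) := by
  have hZ := (partitionFunction_pos b J).ne'
  have hc : ∏ e, Real.cosh (b * J e) ≠ 0 :=
    Finset.prod_ne_zero_iff.2 fun e _ => (Real.cosh_pos _).ne'
  rw [exp_logReduced, gibbsWeight, exp_negHamiltonian]
  field_simp

theorem card_config : (Fintype.card (Config N) : ℝ) = 2 ^ N := by
  simp [Config]

theorem abs_negHamiltonian_le (b : ℝ) (J : Edge N → ℝ) (σ : Config N) :
    |negHamiltonian b J σ| ≤ |b| * ∑ e, |J e| := by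
  rw [negHamiltonian_eq, abs_mul]
  refine mul_le_mul_of_nonneg_left ((Finset.abs_sum_le_sum_abs _ _).trans ?_) (abs_nonneg b)
  simp [abs_mul, abs_edgeSpin]

theorem abs_logReduced_le (b : ℝ) (J : Edge N → ℝ) :
    |logReduced b J| ≤ 2 * (|b| * ∑ e, |J e|) := by
  set S := |b| * ∑ e, |J e| with hS
  have hZ := partitionFunction_pos b J
  have h1 : Real.log (partitionFunction b J) ≤ N * Real.log 2 + S := by
    rw [Real.log_le_iff_le_exp hZ, Real.exp_add, Real.exp_nat_mul, Real.exp_log two_pos,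
      ← card_config, ← Finset.card_univ, ← nsmul_eq_mul]
    exact Finset.sum_le_card_nsmul _ _ _ fun σ _ =>
      Real.exp_le_exp.2 ((le_abs_self _).trans (abs_negHamiltonian_le b J σ))
  have h2 : N * Real.log 2 - S ≤ Real.log (partitionFunction b J) := by
    rw [Real.le_log_iff_exp_le hZ, sub_eq_add_neg, Real.exp_add, Real.exp_nat_mul,
      Real.exp_log two_pos, ← card_config, ← Finset.card_univ, ← nsmul_eq_mul]
    exact Finset.card_nsmul_le_sum _ _ _ fun σ _ =>
      Real.exp_le_exp.2 (by
        have := (abs_le.1 (abs_negHamiltonian_le b J σ)).1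
        linarith)
  have h3 : 0 ≤ ∑ e, Real.log (Real.cosh (b * J e)) :=
    Finset.sum_nonneg fun e _ => Real.log_nonneg (Real.one_le_cosh _)
  have h4 : ∑ e, Real.log (Real.cosh (b * J e)) ≤ S := by
    rw [hS, Finset.mul_sum]
    refine Finset.sum_le_sum fun e _ => ?_
    rw [Real.log_le_iff_le_exp (Real.cosh_pos _), ← abs_mul, ← Real.cosh_abs, ← Real.cosh_add_sinh]
    linarith [Real.sinh_nonneg_iff.2 (abs_nonneg (b * J e))]
  have hS0 : 0 ≤ S := by positivity
  rw [logReduced, abs_le]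
  constructor <;> linarith

theorem exp_overlapSq_le (D b : ℝ) (J : Edge N → ℝ) :
    Real.exp (D * overlapSq b J + 2 * logReduced b J)
      ≤ ∑ τ : Fin 2 → Config N, Real.exp (D * siteOverlap τ ^ 2) *
        ((1 / 2 ^ N) ^ 2 * ∏ e, ((1 + Real.tanh (b * J e) * edgeSpin (τ 0) e) *
          (1 + Real.tanh (b * J e) * edgeSpin (τ 1) e))) := by
  set u := D * overlapSq b J with hu
  have h1 : Real.exp u ≤
      gibbsExp b J fun τ : Fin 2 → Config N => Real.exp (D * siteOverlap τ ^ 2) := by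
    have h2 : gibbsExp b J (fun τ : Fin 2 → Config N =>
        Real.exp u * (1 - u) * 1 + Real.exp u * D * siteOverlap τ ^ 2) = Real.exp u := by
      rw [gibbsExp_add, gibbsExp_const_mul, gibbsExp_const_mul, gibbsExp_one]
      change Real.exp u * (1 - u) * 1 + Real.exp u * D * overlapSq b J = Real.exp u
      rw [hu]; ring
    rw [← h2]
    refine gibbsExp_mono b J fun τ => ?_
    have h3 := Real.add_one_le_exp (D * siteOverlap τ ^ 2 - u)
    have h4 := mul_le_mul_of_nonneg_left h3 (Real.exp_pos u).le
    rw [← Real.exp_add, add_sub_cancel] at h4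
    linarith
  rw [Real.exp_add, two_mul, Real.exp_add]
  refine (mul_le_mul_of_nonneg_right h1 (by positivity)).trans (le_of_eq ?_)
  rw [gibbsExp, Finset.sum_mul]
  refine Finset.sum_congr rfl fun τ _ => ?_
  have h5 := gibbsWeight_mul_exp_logReduced b J (τ 0)
  have h6 := gibbsWeight_mul_exp_logReduced b J (τ 1)
  rw [Fin.prod_univ_two, Finset.prod_mul_distrib, sq (1 / 2 ^ N : ℝ),
    mul_mul_mul_comm (1 / 2 ^ N : ℝ), ← h5, ← h6]
  ring

end Reduced

/-! ### Exponential moments of the overlap of independent uniform configurations -/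

section Uniform

variable {N : ℕ}

/-- The integer `∑_i σ_i τ_i`. -/
def spinInner (σ τ : Config N) : ℤ := ∑ i, ((σ i : ℤ) * (τ i : ℤ))

theorem spinInner_cast (σ τ : Config N) : (spinInner σ τ : ℝ) = ∑ i, spin σ i * spin τ i := by
  simp [spinInner, spin]

theorem abs_spinInner_le (σ τ : Config N) : |spinInner σ τ| ≤ N := by
  refine (Finset.abs_sum_le_sum_abs _ _).trans ?_
  have h : ∀ i, |(σ i : ℤ) * (τ i : ℤ)| = 1 := fun i => by
    rw [← Units.val_mul]
    rcases Int.units_eq_one_or (σ i * τ i) with h | h <;> simp [h]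
  simp [h]

theorem sum_exp_spinInner (c : ℝ) (σ : Config N) :
    ∑ τ : Config N, Real.exp (c * spinInner σ τ) = (2 * Real.cosh c) ^ N := by
  have h : ∀ τ : Config N, Real.exp (c * spinInner σ τ)
      = ∏ i, Real.exp (c * (spin σ i * ((τ i : ℤ) : ℝ))) := fun τ => by
    rw [spinInner_cast, Finset.mul_sum, Real.exp_sum]; rfl
  simp only [h]
  have h2 := (Finset.prod_univ_sum (fun _ : Fin N => (Finset.univ : Finset ℤˣ))
    fun i s => Real.exp (c * (spin σ i * ((s : ℤ) : ℝ)))).symm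
  rw [Fintype.piFinset_univ] at h2
  rw [h2]
  have h3 : ∀ i : Fin N, ∑ s : ℤˣ, Real.exp (c * (spin σ i * ((s : ℤ) : ℝ))) = 2 * Real.cosh c := by
    intro i
    rw [UnitsInt.univ, Finset.sum_pair (by decide), Real.cosh_eq]
    rcases spin_eq σ i with h | h <;> simp [h] <;> ring
  rw [Finset.prod_congr rfl fun i _ => h3 i]
  simp

theorem sum_exp_sq_spinInner_le (hN : 0 < N) (σ : Config N) :
    ∑ τ : Config N, Real.exp ((spinInner σ τ : ℝ) ^ 2 / (2 * N)) ≤ 2 ^ N * (2 * N + 1) := by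
  have hN' : (0 : ℝ) < N := by exact_mod_cast hN
  have h1 : ∀ τ : Config N, Real.exp ((spinInner σ τ : ℝ) ^ 2 / (2 * N))
      ≤ ∑ b ∈ Finset.Icc (-(N : ℤ)) N,
        Real.exp (-(b : ℝ) ^ 2 / (2 * N)) * Real.exp (b / N * spinInner σ τ) := by
    intro τ
    have hmem : spinInner σ τ ∈ Finset.Icc (-(N : ℤ)) N :=
      Finset.mem_Icc.2 (abs_le.1 (abs_spinInner_le σ τ))
    refine le_trans (le_of_eq ?_) (Finset.single_le_sum (f := fun b : ℤ =>
      Real.exp (-(b : ℝ) ^ 2 / (2 * N)) * Real.exp (b / N * spinInner σ τ))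
      (fun b _ => by positivity) hmem)
    rw [← Real.exp_add]
    congr 1
    field_simp
    ring
  refine (Finset.sum_le_sum fun τ _ => h1 τ).trans ?_
  rw [Finset.sum_comm]
  have h2 : ∀ b ∈ Finset.Icc (-(N : ℤ)) N, ∑ τ : Config N,
      Real.exp (-(b : ℝ) ^ 2 / (2 * N)) * Real.exp (b / N * spinInner σ τ) ≤ 2 ^ N := by
    intro b _
    rw [← Finset.mul_sum, sum_exp_spinInner, mul_pow]
    have h3 : Real.cosh ((b : ℝ) / N) ^ N ≤ Real.exp ((b : ℝ) ^ 2 / (2 * N)) := by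
      refine (pow_le_pow_left₀ (Real.cosh_pos _).le (Real.cosh_le_exp_half_sq _) N).trans
        (le_of_eq ?_)
      rw [← Real.exp_nat_mul]
      congr 1
      field_simp
    calc Real.exp (-(b : ℝ) ^ 2 / (2 * N)) * (2 ^ N * Real.cosh ((b : ℝ) / N) ^ N)
        ≤ Real.exp (-(b : ℝ) ^ 2 / (2 * N)) * (2 ^ N * Real.exp ((b : ℝ) ^ 2 / (2 * N))) := by
          gcongr
      _ = 2 ^ N := by
          rw [mul_left_comm, ← Real.exp_add, neg_div, neg_add_cancel, Real.exp_zero, mul_one]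
  refine (Finset.sum_le_card_nsmul _ _ _ h2).trans (le_of_eq ?_)
  rw [nsmul_eq_mul, Int.card_Icc, mul_comm]
  congr 1
  have : ((N : ℤ) + 1 - -(N : ℤ)).toNat = 2 * N + 1 := by omega
  rw [this]
  push_cast
  ring

theorem sum_edge_eq_sum_filter (F : Fin N × Fin N → ℝ) :
    ∑ e : Edge N, F e.1 = ∑ p : Fin N × Fin N, if p.1 < p.2 then F p else 0 := by
  rw [← Finset.sum_filter]
  exact (Finset.sum_subtype _ (by simp) F).symm

theorem two_mul_sum_edge_add (ρ : Fin N → ℝ) :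
    2 * ∑ e : Edge N, ρ e.1.1 * ρ e.1.2 + ∑ i, ρ i ^ 2 = (∑ i, ρ i) ^ 2 := by
  rw [sum_edge_eq_sum_filter fun p => ρ p.1 * ρ p.2, Fintype.sum_prod_type, two_mul]
  nth_rewrite 2 [Finset.sum_comm]
  rw [sq, Finset.sum_mul_sum, ← Finset.sum_add_distrib, ← Finset.sum_add_distrib]
  refine Finset.sum_congr rfl fun i _ => ?_
  have h : ρ i ^ 2 = ∑ j, if i = j then ρ i * ρ j else 0 := by simp [sq]
  rw [h, ← Finset.sum_add_distrib, ← Finset.sum_add_distrib]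
  refine Finset.sum_congr rfl fun j _ => ?_
  rcases lt_trichotomy i j with hij | hij | hij
  · simp [hij, hij.not_gt, hij.ne]
  · simp [hij]
  · simp [hij, hij.not_gt, hij.ne', mul_comm]

theorem sum_edge_inner_le (σ τ : Config N) :
    ∑ e : Edge N, edgeSpin σ e * edgeSpin τ e ≤ (spinInner σ τ : ℝ) ^ 2 / 2 := by
  have h := two_mul_sum_edge_add fun i => spin σ i * spin τ i
  rw [← spinInner_cast] at h
  have h2 : 0 ≤ ∑ i, (spin σ i * spin τ i) ^ 2 := Finset.sum_nonneg fun _ _ => sq_nonneg _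
  have h3 : ∑ e : Edge N, edgeSpin σ e * edgeSpin τ e
      = ∑ e : Edge N, (spin σ e.1.1 * spin τ e.1.1) * (spin σ e.1.2 * spin τ e.1.2) :=
    Finset.sum_congr rfl fun e _ => by simp only [edgeSpin]; ring
  rw [h3]
  linarith

theorem sum_fin_two_config (F : Config N → Config N → ℝ) :
    ∑ τ : Fin 2 → Config N, F (τ 0) (τ 1) = ∑ σ, ∑ τ, F σ τ := by
  rw [← Fintype.sum_prod_type']
  exact Fintype.sum_equiv (finTwoArrowEquiv (Config N)) _ _ fun τ => rfl

end Uniform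

/-! ### The second moment bound -/

section SecondMoment

variable {α : ℝ} {N : ℕ}

/-- The joint law of all couplings. -/
def disorderMeasure (α : ℝ) (N : ℕ) : Measure (Edge N → ℝ) :=
  Measure.pi fun _ => disorderLaw α N

variable [IsProbabilityMeasure (disorderLaw α N)]

instance : IsProbabilityMeasure (disorderMeasure α N) := by
  unfold disorderMeasure; infer_instance

theorem continuous_tanh_coord (b : ℝ) (e : Edge N) :
    Continuous fun J : Edge N → ℝ => Real.tanh (b * J e) :=
  continuous_tanh.comp (by fun_prop)

theorem integrable_of_measurable_bound {Ω : Type*} [MeasurableSpace Ω] {μ : Measure Ω}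
    [IsFiniteMeasure μ] {f : Ω → ℝ} (hf : Measurable f) {C : ℝ} (h : ∀ x, |f x| ≤ C) :
    Integrable f μ :=
  Integrable.of_bound hf.aestronglyMeasurable C (Eventually.of_forall h)

theorem integrable_tanh (b : ℝ) : Integrable (fun x => Real.tanh (b * x)) (disorderLaw α N) :=
  integrable_of_measurable_bound (measurable_tanh.comp (measurable_const_mul b))
    fun _ => (Real.abs_tanh_lt_one _).le

theorem integrable_tanh_sq (b : ℝ) :
    Integrable (fun x => Real.tanh (b * x) ^ 2) (disorderLaw α N) :=
  integrable_of_measurable_bound ((measurable_tanh.comp (measurable_const_mul b)).pow_const 2)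
    (C := 1) fun x => by
      rw [abs_of_nonneg (sq_nonneg _)]
      exact (Real.tanh_sq_lt_one _).le

theorem integral_one_add_tanh_mul (b s s' : ℝ) :
    ∫ x, (1 + Real.tanh (b * x) * s) * (1 + Real.tanh (b * x) * s') ∂(disorderLaw α N)
      = 1 + (∫ x, Real.tanh (b * x) ^ 2 ∂(disorderLaw α N)) * (s * s') := by
  have h : ∀ x, (1 + Real.tanh (b * x) * s) * (1 + Real.tanh (b * x) * s')
      = 1 + (Real.tanh (b * x) * (s + s') + Real.tanh (b * x) ^ 2 * (s * s')) := fun x => by ring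
  have h1 := (integrable_tanh (α := α) (N := N) b).mul_const (s + s')
  have h2 := (integrable_tanh_sq (α := α) (N := N) b).mul_const (s * s')
  simp only [h]
  rw [integral_add (integrable_const _) (h1.fun_add h2), integral_add h1 h2, integral_mul_const,
    integral_mul_const, integral_odd_disorderLaw N (f := fun x => Real.tanh (b * x))
      fun x => by rw [mul_neg, Real.tanh_neg]]
  simp

theorem integral_tanh_sq_le_of_le (hα₁ : 1 < α) (hα₂ : α < 2) (hN : 0 < N) {b β : ℝ}
    (hb : 0 ≤ b) (hbβ : b ≤ β) :
    ∫ x, Real.tanh (b * x) ^ 2 ∂(disorderLaw α N) ≤ tanhConst α β / N := by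
  refine le_trans (integral_mono (integrable_tanh_sq b) (integrable_tanh_sq β) fun x => ?_)
    (integral_tanh_sq_le hα₁ hα₂ (hb.trans hbβ) hN)
  simp only
  rw [← sq_abs, ← sq_abs (Real.tanh (β * x)), ← tanh_abs, ← tanh_abs, abs_mul, abs_mul,
    abs_of_nonneg hb, abs_of_nonneg (hb.trans hbβ)]
  exact pow_le_pow_left₀ (tanh_nonneg (by positivity))
    (tanh_mono (mul_le_mul_of_nonneg_right hbβ (abs_nonneg x))) 2

theorem integrable_prod_replica (b : ℝ) (σ τ : Config N) :
    Integrable (fun J : Edge N → ℝ => ∏ e, ((1 + Real.tanh (b * J e) * edgeSpin σ e) *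
          (1 + Real.tanh (b * J e) * edgeSpin τ e))) (disorderMeasure α N) := by
  refine integrable_of_measurable_bound (C := ∏ _e : Edge N, 2 * 2) ?_ fun J => ?_
  · refine Continuous.measurable ?_
    have := fun e => continuous_tanh_coord (N := N) b e
    fun_prop
  · rw [Finset.abs_prod]
    have h : ∀ (σ : Config N) (e : Edge N), |1 + Real.tanh (b * J e) * edgeSpin σ e| ≤ 2 := by
      intro σ e
      refine (abs_add_le _ _).trans ?_
      rw [abs_mul, abs_edgeSpin, abs_one, mul_one]
      linarith [Real.abs_tanh_lt_one (b * J e)]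
    refine Finset.prod_le_prod (fun _ _ => abs_nonneg _) fun e _ => ?_
    rw [abs_mul]
    exact mul_le_mul (h σ e) (h τ e) (abs_nonneg _) (by norm_num)

theorem integral_prod_replica_le (hα₁ : 1 < α) (hα₂ : α < 2) (hN : 0 < N) {b β : ℝ}
    (hb : 0 ≤ b) (hbβ : b ≤ β) (σ τ : Config N) :
    ∫ J : Edge N → ℝ, ∏ e, ((1 + Real.tanh (b * J e) * edgeSpin σ e) *
          (1 + Real.tanh (b * J e) * edgeSpin τ e)) ∂(disorderMeasure α N)
      ≤ Real.exp (tanhConst α β / N * ((spinInner σ τ : ℝ) ^ 2 / 2)) := by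
  have hN' : (0 : ℝ) < N := by exact_mod_cast hN
  have h := integral_fintype_prod_eq_prod (𝕜 := ℝ)
    (fun (e : Edge N) (x : ℝ) => (1 + Real.tanh (b * x) * edgeSpin σ e) *
          (1 + Real.tanh (b * x) * edgeSpin τ e)) (μ := fun _ => disorderLaw α N)
  unfold disorderMeasure
  rw [h]
  simp only [integral_one_add_tanh_mul]
  set v := ∫ x, Real.tanh (b * x) ^ 2 ∂(disorderLaw α N)
  have hv0 : 0 ≤ v := integral_nonneg fun x => sq_nonneg _
  have hv1 : v ≤ 1 := by
    have := integral_mono (integrable_tanh_sq (α := α) (N := N) b) (integrable_const (1 : ℝ))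
      fun x => (Real.tanh_sq_lt_one (b * x)).le
    simpa using this
  have hv : v ≤ tanhConst α β / N := integral_tanh_sq_le_of_le hα₁ hα₂ hN hb hbβ
  calc ∏ e, (1 + v * (edgeSpin σ e * edgeSpin τ e))
      ≤ ∏ e, Real.exp (v * (edgeSpin σ e * edgeSpin τ e)) := by
        refine Finset.prod_le_prod (fun e _ => ?_) fun e _ => ?_
        · rcases edgeSpin_eq σ e with h | h <;> rcases edgeSpin_eq τ e with h' | h' <;>
            rw [h, h'] <;> linarith
        · rw [add_comm]; exact Real.add_one_le_exp _
    _ = Real.exp (v * ∑ e, edgeSpin σ e * edgeSpin τ e) := by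
        rw [← Real.exp_sum, Finset.mul_sum]
    _ ≤ Real.exp (tanhConst α β / N * ((spinInner σ τ : ℝ) ^ 2 / 2)) := by
        refine Real.exp_le_exp.2 ?_
        exact (mul_le_mul_of_nonneg_left (sum_edge_inner_le σ τ) hv0).trans
          (mul_le_mul_of_nonneg_right hv (by positivity))

theorem siteOverlap_eq_spinInner (τ : Fin 2 → Config N) :
    siteOverlap τ = spinInner (τ 0) (τ 1) / N := by
  rw [siteOverlap, spinInner_cast]
  simp only [Fin.prod_univ_two]
  ring

/-- The replica sum dominating `exp (D ⟨R²⟩) Ẑ²`. -/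
def replicaSum (D b : ℝ) (J : Edge N → ℝ) : ℝ :=
  ∑ τ : Fin 2 → Config N, Real.exp (D * siteOverlap τ ^ 2) *
    ((1 / 2 ^ N) ^ 2 * ∏ e, ((1 + Real.tanh (b * J e) * edgeSpin (τ 0) e) *
      (1 + Real.tanh (b * J e) * edgeSpin (τ 1) e)))

theorem integrable_replicaSum (D b : ℝ) :
    Integrable (replicaSum (N := N) D b) (disorderMeasure α N) :=
  integrable_finsetSum _ fun τ _ => ((integrable_prod_replica b (τ 0) (τ 1)).const_mul _).const_mul _

theorem integral_replicaSum_le (hα₁ : 1 < α) (hα₂ : α < 2) (hN : 0 < N) {b β : ℝ}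
    (hb : 0 ≤ b) (hbβ : b ≤ β) :
    ∫ J, replicaSum ((1 - tanhConst α β) / 2 * N) b J ∂(disorderMeasure α N) ≤ 2 * N + 1 := by
  have hN' : (0 : ℝ) < N := by exact_mod_cast hN
  set D := (1 - tanhConst α β) / 2 * N with hD
  unfold replicaSum
  rw [integral_finsetSum _ fun τ _ =>
    ((integrable_prod_replica b (τ 0) (τ 1)).const_mul _).const_mul _]
  simp only [integral_const_mul]
  calc _ ≤ ∑ τ : Fin 2 → Config N, (1 / 2 ^ N) ^ 2 *
        Real.exp ((spinInner (τ 0) (τ 1) : ℝ) ^ 2 / (2 * N)) := by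
        refine Finset.sum_le_sum fun τ _ => ?_
        rw [mul_left_comm]
        refine mul_le_mul_of_nonneg_left ?_ (by positivity)
        refine (mul_le_mul_of_nonneg_left (integral_prod_replica_le hα₁ hα₂ hN hb hbβ _ _)
          (Real.exp_pos _).le).trans (le_of_eq ?_)
        rw [← Real.exp_add, siteOverlap_eq_spinInner, hD]
        congr 1
        field_simp
        ring
    _ = (1 / 2 ^ N) ^ 2 * ∑ σ : Config N, ∑ τ : Config N,
        Real.exp ((spinInner σ τ : ℝ) ^ 2 / (2 * N)) := by
        rw [← Finset.mul_sum,
          sum_fin_two_config fun σ τ => Real.exp ((spinInner σ τ : ℝ) ^ 2 / (2 * N))]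
    _ ≤ (1 / 2 ^ N) ^ 2 * ∑ _σ : Config N, 2 ^ N * ((2 : ℝ) * N + 1) := by
        refine mul_le_mul_of_nonneg_left ?_ (by positivity)
        exact Finset.sum_le_sum fun σ _ => sum_exp_sq_spinInner_le hN σ
    _ = 2 * N + 1 := by
        rw [Finset.sum_const, nsmul_eq_mul, Finset.card_univ, card_config]
        field_simp

theorem continuous_partitionFunction (b : ℝ) :
    Continuous fun J : Edge N → ℝ => partitionFunction b J := by
  unfold partitionFunction negHamiltonian; fun_prop

theorem continuous_gibbsWeight (b : ℝ) (σ : Config N) :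
    Continuous fun J : Edge N → ℝ => gibbsWeight b J σ := by
  unfold gibbsWeight
  refine Continuous.div ?_ (continuous_partitionFunction b) fun J =>
    (partitionFunction_pos b J).ne'
  unfold negHamiltonian; fun_prop

theorem continuous_gibbsMean (b : ℝ) (f : Config N → ℝ) :
    Continuous fun J : Edge N → ℝ => gibbsMean b J f :=
  continuous_finsetSum _ fun σ _ => (continuous_gibbsWeight b σ).mul continuous_const

theorem continuous_gibbsExp {n : ℕ} (b : ℝ) (f : (Fin n → Config N) → ℝ) :
    Continuous fun J : Edge N → ℝ => gibbsExp b J f :=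
  continuous_finsetSum _ fun τ _ =>
    (continuous_finsetProd _ fun l _ => continuous_gibbsWeight b (τ l)).mul continuous_const

theorem integrable_overlapSq (b : ℝ) :
    Integrable (fun J : Edge N → ℝ => overlapSq b J) (disorderMeasure α N) :=
  integrable_of_measurable_bound (continuous_gibbsExp b _).measurable (C := 1) fun J => by
    rw [abs_of_nonneg (overlapSq_nonneg b J)]
    exact overlapSq_le_one b J

theorem continuous_logReduced (b : ℝ) : Continuous fun J : Edge N → ℝ => logReduced b J := by
  unfold logReduced
  refine ((Continuous.log (continuous_partitionFunction b) fun J =>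
    (partitionFunction_pos b J).ne').sub continuous_const).sub ?_
  refine continuous_finsetSum _ fun e _ => Continuous.log ?_ fun J => (Real.cosh_pos _).ne'
  exact Real.continuous_cosh.comp (by fun_prop)

theorem integrable_coord_of_integrable {f : ℝ → ℝ} (hf : Integrable f (disorderLaw α N))
    (e : Edge N) : Integrable (fun J : Edge N → ℝ => f (J e)) (disorderMeasure α N) :=
  ((measurePreserving_eval (fun _ : Edge N => disorderLaw α N) e).integrable_comp
    hf.aestronglyMeasurable).2 hf

theorem integral_coord {f : ℝ → ℝ} (hf : AEStronglyMeasurable f (disorderLaw α N)) (e : Edge N) :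
    ∫ J, f (J e) ∂(disorderMeasure α N) = ∫ x, f x ∂(disorderLaw α N) := by
  have h := (measurePreserving_eval (fun _ : Edge N => disorderLaw α N) e)
  rw [← h.map_eq] at hf ⊢
  exact (integral_map h.measurable.aemeasurable hf).symm

theorem integrable_sum_abs (hα₁ : 1 < α) (hα₂ : α < 2) (hN : 0 < N) :
    Integrable (fun J : Edge N → ℝ => ∑ e, |J e|) (disorderMeasure α N) :=
  integrable_finsetSum _ fun e _ =>
    integrable_coord_of_integrable (integrable_abs_disorderLaw hα₁ hα₂ hN) e

theorem integrable_logReduced (hα₁ : 1 < α) (hα₂ : α < 2) (hN : 0 < N) (b : ℝ) :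
    Integrable (fun J : Edge N → ℝ => logReduced b J) (disorderMeasure α N) :=
  (((integrable_sum_abs hα₁ hα₂ hN).const_mul |b|).const_mul 2).mono'
    (continuous_logReduced b).aestronglyMeasurable
    (Eventually.of_forall fun J => abs_logReduced_le b J)

/-- The second moment bound on the overlap in terms of the mean reduced free energy. -/
theorem integral_overlapSq_add_le (hα₁ : 1 < α) (hα₂ : α < 2) (hN : 0 < N) {b β : ℝ}
    (hb : 0 ≤ b) (hbβ : b ≤ β) :
    (1 - tanhConst α β) / 2 * N * (∫ J, overlapSq b J ∂(disorderMeasure α N))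
      + 2 * (∫ J, logReduced b J ∂(disorderMeasure α N)) ≤ Real.log (2 * N + 1) := by
  have hC : (0 : ℝ) < 2 * N + 1 := by positivity
  set D := (1 - tanhConst α β) / 2 * N with hD
  have hpt : ∀ J : Edge N → ℝ, D * overlapSq b J + 2 * logReduced b J
      ≤ replicaSum D b J / (2 * N + 1) + (Real.log (2 * N + 1) - 1) := by
    intro J
    have h1 := Real.add_one_le_exp
      (D * overlapSq b J + 2 * logReduced b J - Real.log (2 * N + 1))
    rw [Real.exp_sub, Real.exp_log hC] at h1
    have h2 := div_le_div_of_nonneg_right (exp_overlapSq_le D b J) hC.le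
    unfold replicaSum
    linarith
  have hi1 := (integrable_overlapSq (α := α) (N := N) b).const_mul D
  have hi2 := (integrable_logReduced hα₁ hα₂ hN b).const_mul 2
  have hi3 := (integrable_replicaSum (α := α) (N := N) D b).div_const (2 * N + 1)
  have h3 := integral_mono (hi1.fun_add hi2) (hi3.fun_add (integrable_const (Real.log (2 * N + 1) - 1))) hpt
  have h4 : ∫ J, D * overlapSq b J + 2 * logReduced b J ∂(disorderMeasure α N) = D * (∫ J, overlapSq b J ∂(disorderMeasure α N))
        + 2 * ∫ J, logReduced b J ∂(disorderMeasure α N) := by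
    rw [integral_add hi1 hi2, integral_const_mul, integral_const_mul]
  have h5 : ∫ J, replicaSum D b J / (2 * N + 1) + (Real.log (2 * N + 1) - 1) ∂(disorderMeasure α N) = (∫ J, replicaSum D b J ∂(disorderMeasure α N)) / (2 * N + 1)
        + (Real.log (2 * N + 1) - 1) := by
    rw [integral_add hi3 (integrable_const _), integral_div]
    simp
  rw [← h4]
  refine h3.trans ?_
  rw [h5]
  have h6 : (∫ J, replicaSum D b J ∂(disorderMeasure α N)) / (2 * N + 1) ≤ 1 :=
    (div_le_one hC).2 (integral_replicaSum_le hα₁ hα₂ hN hb hbβ)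
  linarith

end SecondMoment

/-! ### The derivative of the reduced free energy -/

section Derivative

variable {N : ℕ}

theorem hasDerivAt_logReduced (J : Edge N → ℝ) (b : ℝ) :
    HasDerivAt (fun b => logReduced b J)
      (∑ e, J e * ((gibbsMean b J fun σ => edgeSpin σ e) - Real.tanh (b * J e))) b := by
  have h1 : ∀ σ : Config N, HasDerivAt (fun b => Real.exp (negHamiltonian b J σ))
      (Real.exp (negHamiltonian b J σ) * ∑ e, J e * edgeSpin σ e) b := fun σ => by
    simp only [negHamiltonian_eq]
    simpa using ((hasDerivAt_id b).mul_const (∑ e, J e * edgeSpin σ e)).exp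
  have h2 : HasDerivAt (fun b => partitionFunction b J)
      (∑ σ, Real.exp (negHamiltonian b J σ) * ∑ e, J e * edgeSpin σ e) b :=
    HasDerivAt.fun_sum fun σ _ => h1 σ
  have h3 := h2.log (partitionFunction_pos b J).ne'
  have h4 : HasDerivAt (fun b => ∑ e, Real.log (Real.cosh (b * J e)))
      (∑ e, J e * Real.tanh (b * J e)) b := by
    refine HasDerivAt.fun_sum fun e _ => ?_
    have := ((hasDerivAt_id b).mul_const (J e)).cosh.log (Real.cosh_pos _).ne'
    refine this.congr_deriv ?_
    simp only [id, one_mul]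
    rw [Real.tanh_eq_sinh_div_cosh]
    ring
  refine ((h3.sub_const (N * Real.log 2)).sub h4).congr_deriv ?_
  simp only [mul_sub, Finset.sum_sub_distrib]
  congr 1
  rw [Finset.sum_div]
  simp only [gibbsMean, gibbsWeight, Finset.mul_sum]
  rw [Finset.sum_comm]
  refine Finset.sum_congr rfl fun σ _ => ?_
  rw [Finset.sum_div]
  exact Finset.sum_congr rfl fun e _ => by ring

theorem logReduced_zero (J : Edge N → ℝ) : logReduced 0 J = 0 := by
  have : partitionFunction 0 J = 2 ^ N := by
    simp [partitionFunction, negHamiltonian]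
  simp [logReduced, this]

theorem abs_mean_sub_tanh_le_two (b : ℝ) (J : Edge N → ℝ) (e : Edge N) :
    |(gibbsMean b J fun σ => edgeSpin σ e) - Real.tanh (b * J e)| ≤ 2 :=
  (abs_sub _ _).trans (by
    linarith [abs_gibbsMean_edgeSpin_le b J e, Real.abs_tanh_lt_one (b * J e)])

/-- Reversal of the sign of one coupling. -/
def flipEdge (e : Edge N) (J : Edge N → ℝ) : Edge N → ℝ := Function.update J e (-J e)

theorem symmetrized_drift_ge {x t m p r : ℝ} (ht : |t| < 1) (hm : |m| ≤ 1)
    (hp : p * (1 + t * m) = m + t) (hr : r * (1 + (-t) * m) = m + (-t)) :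
    -(2 * (|x * t| * m ^ 2)) ≤ x * (p - t) + (-x) * (r - (-t)) := by
  have htm : |t * m| < 1 := by
    rw [abs_mul]
    exact (mul_le_of_le_one_right (abs_nonneg t) hm).trans_lt ht
  have h1 : 0 < 1 + t * m := by linarith [(abs_lt.1 htm).1]
  have h2 : 0 < 1 - t * m := by linarith [(abs_lt.1 htm).2]
  have ht2 : 0 ≤ 1 - t ^ 2 := by
    have := (sq_lt_one_iff_abs_lt_one t).2 ht
    linarith
  have hm2 : m ^ 2 ≤ 1 := (sq_le_one_iff_abs_le_one m).2 hm
  have hpe : p - t = m * (1 - t ^ 2) / (1 + t * m) := by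
    rw [eq_div_iff h1.ne']; linear_combination hp
  have hre : r - (-t) = m * (1 - t ^ 2) / (1 - t * m) := by
    rw [eq_div_iff h2.ne']; linear_combination hr
  have hD : 0 < (1 + t * m) * (1 - t * m) := mul_pos h1 h2
  have hsum : x * (p - t) + (-x) * (r - (-t))
      = -(2 * (x * t * m ^ 2)) * ((1 - t ^ 2) / ((1 + t * m) * (1 - t * m))) := by
    have h1' := h1.ne'
    have h2' := h2.ne'
    rw [hpe, hre, mul_div_assoc', mul_div_assoc', mul_div_assoc', div_add_div _ _ h1' h2']
    congr 1
    ring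
  have hq0 : 0 ≤ (1 - t ^ 2) / ((1 + t * m) * (1 - t * m)) := div_nonneg ht2 hD.le
  have hq1 : (1 - t ^ 2) / ((1 + t * m) * (1 - t * m)) ≤ 1 := by
    rw [div_le_one hD]
    nlinarith [mul_le_mul_of_nonneg_left hm2 (sq_nonneg t)]
  rw [hsum]
  set Q := (1 - t ^ 2) / ((1 + t * m) * (1 - t * m))
  have h3 : x * t * m ^ 2 * Q ≤ |x * t| * m ^ 2 := by
    calc x * t * m ^ 2 * Q ≤ |x * t| * m ^ 2 * Q := by
          gcongr; exact le_abs_self _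
      _ ≤ |x * t| * m ^ 2 := mul_le_of_le_one_right (by positivity) hq1
  linarith

theorem drift_add_flip_ge (b : ℝ) (J : Edge N → ℝ) (e : Edge N) :
    -(2 * (|J e * Real.tanh (b * J e)| *
        (gibbsMean b (Function.update J e 0) fun σ => edgeSpin σ e) ^ 2))
      ≤ J e * ((gibbsMean b J fun σ => edgeSpin σ e) - Real.tanh (b * J e))
        + flipEdge e J e * ((gibbsMean b (flipEdge e J) fun σ => edgeSpin σ e)
          - Real.tanh (b * flipEdge e J e)) := by
  have h1 := gibbsMean_mul_update b J e fun σ => edgeSpin σ e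
  have h2 := gibbsMean_mul_update b (flipEdge e J) e fun σ => edgeSpin σ e
  have hone : ∀ J : Edge N → ℝ, (gibbsMean b J fun _ => (1 : ℝ)) = 1 := fun J => by
    simp [gibbsMean, sum_gibbsWeight]
  simp only [edgeSpin_mul_self, hone, mul_one] at h1 h2
  have hf : flipEdge e J e = -J e := by simp [flipEdge]
  have hu : Function.update (flipEdge e J) e 0 = Function.update J e 0 := by simp [flipEdge]
  rw [hu, hf, mul_neg, Real.tanh_neg] at h2
  rw [hf, mul_neg b, Real.tanh_neg]
  exact symmetrized_drift_ge (Real.abs_tanh_lt_one _) (abs_gibbsMean_edgeSpin_le _ _ _) h1 h2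

end Derivative

theorem integrable_mul_tanh {α : ℝ} {N : ℕ} (hα₁ : 1 < α) (hα₂ : α < 2) (hN : 0 < N) (b : ℝ) :
    Integrable (fun x => |x * Real.tanh (b * x)|) (disorderLaw α N) := by
  refine (integrable_abs_disorderLaw hα₁ hα₂ hN).mono' ?_ (Eventually.of_forall fun x => ?_)
  · have := measurable_tanh
    exact Measurable.aestronglyMeasurable (by fun_prop)
  · rw [Real.norm_eq_abs, abs_abs, mul_comm]
    exact abs_mul_le_of_abs_le_one (Real.abs_tanh_lt_one _).le

theorem integral_abs_mul_tanh_le_of_le {α : ℝ} {N : ℕ} (hα₁ : 1 < α) (hα₂ : α < 2) (hN : 0 < N) {b β : ℝ}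
    (hb : 0 ≤ b) (hbβ : b ≤ β) :
    ∫ x, |x * Real.tanh (b * x)| ∂(disorderLaw α N) ≤ driftConst α β / N := by
  refine le_trans (integral_mono (integrable_mul_tanh hα₁ hα₂ hN b)
    (integrable_mul_tanh hα₁ hα₂ hN β) fun x => ?_)
    (integral_abs_mul_tanh_le hα₁ hα₂ (hb.trans hbβ) hN)
  simp only
  rw [abs_mul, abs_mul, ← tanh_abs, ← tanh_abs, abs_mul, abs_mul,
    abs_of_nonneg hb, abs_of_nonneg (hb.trans hbβ)]
  exact mul_le_mul_of_nonneg_left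
    (tanh_mono (mul_le_mul_of_nonneg_right hbβ (abs_nonneg x))) (abs_nonneg x)

section Drift

variable {α : ℝ} {N : ℕ} [IsProbabilityMeasure (disorderLaw α N)]

theorem measurePreserving_flipEdge (e : Edge N) :
    MeasurePreserving (flipEdge e) (disorderMeasure α N) (disorderMeasure α N) := by
  have h := measurePreserving_pi (fun _ : Edge N => disorderLaw α N)
    (fun _ : Edge N => disorderLaw α N) (f := fun e' x => if e' = e then -x else x) fun e' => by
      by_cases h : e' = e
      · simpa [h] using measurePreserving_neg_disorderLaw α N
      · simp only [h, if_false]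
        exact MeasurePreserving.id (disorderLaw α N)
  refine (congrArg (fun f => MeasurePreserving f (disorderMeasure α N) (disorderMeasure α N)) ?_).mp h
  funext J e'
  by_cases h : e' = e
  · subst h; simp [flipEdge]
  · simp [flipEdge, h]

/-- Functions of disjoint sets of couplings are uncorrelated. -/
theorem integral_mul_of_disjoint {S T : Finset (Edge N)} (hST : Disjoint S T)
    {f g : (Edge N → ℝ) → ℝ} (hf : Measurable f) (hg : Measurable g)
    (hfS : ∀ J J' : Edge N → ℝ, (∀ e ∈ S, J e = J' e) → f J = f J')
    (hgT : ∀ J J' : Edge N → ℝ, (∀ e ∈ T, J e = J' e) → g J = g J') :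
    ∫ J, f J * g J ∂(disorderMeasure α N)
      = (∫ J, f J ∂(disorderMeasure α N)) * ∫ J, g J ∂(disorderMeasure α N) := by
  have hind : iIndepFun (fun (e : Edge N) (J : Edge N → ℝ) => J e) (disorderMeasure α N) :=
    iIndepFun_pi (X := fun _ x => x) fun _ => aemeasurable_id
  let ext : (U : Finset (Edge N)) → (U → ℝ) → Edge N → ℝ :=
    fun U y e => if h : e ∈ U then y ⟨e, h⟩ else 0
  have hext : ∀ U, Measurable (ext U) := fun U => by
    refine measurable_pi_lambda _ fun e => ?_
    by_cases h : e ∈ U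
    · simpa [ext, h] using measurable_pi_apply _
    · simp [ext, h]
  have h := (hind.indepFun_finset S T hST fun e => measurable_pi_apply e).comp
    (hf.comp (hext S)) (hg.comp (hext T))
  have h1 : (f ∘ ext S) ∘ (fun (J : Edge N → ℝ) (i : S) => J i) = f := by
    funext J
    exact hfS _ _ fun e he => by simp [ext, he]
  have h2 : (g ∘ ext T) ∘ (fun (J : Edge N → ℝ) (i : T) => J i) = g := by
    funext J
    exact hgT _ _ fun e he => by simp [ext, he]
  rw [h1, h2] at h
  exact h.integral_fun_mul_eq_mul_integral hf.aestronglyMeasurable hg.aestronglyMeasurable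

theorem integrable_coord_mul {f : (Edge N → ℝ) → ℝ} (hα₁ : 1 < α) (hα₂ : α < 2) (hN : 0 < N)
    (hf : Measurable f) {C : ℝ} (h : ∀ J, |f J| ≤ C) (e : Edge N) :
    Integrable (fun J => J e * f J) (disorderMeasure α N) := by
  refine ((integrable_coord_of_integrable (integrable_abs_disorderLaw hα₁ hα₂ hN) e).const_mul
    C).mono' ((measurable_pi_apply e).mul hf).aestronglyMeasurable
    (Eventually.of_forall fun J => ?_)
  rw [Real.norm_eq_abs, abs_mul, mul_comm]
  exact mul_le_mul_of_nonneg_right (h J) (abs_nonneg _)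

theorem measurable_drift (b : ℝ) (e : Edge N) : Measurable fun J : Edge N → ℝ =>
    (gibbsMean b J fun σ => edgeSpin σ e) - Real.tanh (b * J e) :=
  ((continuous_gibbsMean b _).sub (continuous_tanh_coord b e)).measurable

theorem integrable_drift (hα₁ : 1 < α) (hα₂ : α < 2) (hN : 0 < N) (b : ℝ) (e : Edge N) :
    Integrable (fun J : Edge N → ℝ =>
      J e * ((gibbsMean b J fun σ => edgeSpin σ e) - Real.tanh (b * J e)))
      (disorderMeasure α N) :=
  integrable_coord_mul hα₁ hα₂ hN (measurable_drift b e)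
    (fun J => abs_mean_sub_tanh_le_two b J e) e

theorem hasDerivAt_integral_logReduced (hα₁ : 1 < α) (hα₂ : α < 2) (hN : 0 < N) (b : ℝ) :
    HasDerivAt (fun b => ∫ J : Edge N → ℝ, logReduced b J ∂(disorderMeasure α N))
      (∑ e, ∫ J : Edge N → ℝ, J e * ((gibbsMean b J fun σ => edgeSpin σ e) - Real.tanh (b * J e))
        ∂(disorderMeasure α N)) b := by
  rw [← integral_finsetSum _ fun e _ => integrable_drift hα₁ hα₂ hN b e]
  have hm : Measurable fun J : Edge N → ℝ =>
      ∑ e, J e * ((gibbsMean b J fun σ => edgeSpin σ e) - Real.tanh (b * J e)) :=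
    Finset.measurable_sum _ fun e _ => (measurable_pi_apply e).mul (measurable_drift b e)
  have hbound : ∀ (J : Edge N → ℝ) (b : ℝ),
      ‖∑ e, J e * ((gibbsMean b J fun σ => edgeSpin σ e) - Real.tanh (b * J e))‖
        ≤ 2 * ∑ e, |J e| := fun J b => by
    rw [Real.norm_eq_abs, Finset.mul_sum]
    refine (Finset.abs_sum_le_sum_abs _ _).trans (Finset.sum_le_sum fun e _ => ?_)
    rw [abs_mul, mul_comm]
    exact mul_le_mul_of_nonneg_right (abs_mean_sub_tanh_le_two b J e) (abs_nonneg _)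
  exact (hasDerivAt_integral_of_dominated_loc_of_deriv_le (s := Set.univ)
    (F := fun b (J : Edge N → ℝ) => logReduced b J)
    (F' := fun b (J : Edge N → ℝ) =>
      ∑ e, J e * ((gibbsMean b J fun σ => edgeSpin σ e) - Real.tanh (b * J e)))
    (bound := fun J => 2 * ∑ e, |J e|)
    univ_mem (Eventually.of_forall fun b => (continuous_logReduced b).aestronglyMeasurable)
    (integrable_logReduced hα₁ hα₂ hN b) hm.aestronglyMeasurable
    (Eventually.of_forall fun J b _ => hbound J b) ((integrable_sum_abs hα₁ hα₂ hN).const_mul 2)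
    (Eventually.of_forall fun J b _ => hasDerivAt_logReduced J b)).2

theorem measurable_cavity (b : ℝ) (e : Edge N) (f : Config N → ℝ) :
    Measurable fun J : Edge N → ℝ => gibbsMean b (Function.update J e 0) f :=
  ((continuous_gibbsMean b f).comp (continuous_id.update e continuous_const)).measurable

theorem integral_mul_cavity (b : ℝ) (e : Edge N) :
    ∫ J : Edge N → ℝ, |J e * Real.tanh (b * J e)| *
        (gibbsMean b (Function.update J e 0) fun σ => edgeSpin σ e) ^ 2 ∂(disorderMeasure α N)
      = (∫ x, |x * Real.tanh (b * x)| ∂(disorderLaw α N)) * ∫ J : Edge N → ℝ,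
        (gibbsMean b (Function.update J e 0) fun σ => edgeSpin σ e) ^ 2 ∂(disorderMeasure α N) := by
  have hm : Measurable fun x : ℝ => |x * Real.tanh (b * x)| := by
    have := measurable_tanh
    fun_prop
  rw [integral_mul_of_disjoint (S := {e}) (T := {e}ᶜ) disjoint_compl_right
    (f := fun J => |J e * Real.tanh (b * J e)|)
    (g := fun J => (gibbsMean b (Function.update J e 0) fun σ => edgeSpin σ e) ^ 2)
    (hm.comp (measurable_pi_apply e)) ((measurable_cavity b e _).pow_const 2)
    (fun J J' h => by simp [h e (by simp)]) (fun J J' h => ?_)]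
  · rw [integral_coord (f := fun x => |x * Real.tanh (b * x)|) hm.aestronglyMeasurable e]
  · have : Function.update J e 0 = Function.update J' e 0 := by
      funext e'
      by_cases he : e' = e
      · subst he; simp
      · simp [he, h e' (by simpa using he)]
    rw [this]

theorem integral_drift_ge (hα₁ : 1 < α) (hα₂ : α < 2) (hN : 0 < N) (b : ℝ) (e : Edge N) :
    -((∫ x, |x * Real.tanh (b * x)| ∂(disorderLaw α N)) * ∫ J : Edge N → ℝ,
        (gibbsMean b (Function.update J e 0) fun σ => edgeSpin σ e) ^ 2 ∂(disorderMeasure α N))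
      ≤ ∫ J : Edge N → ℝ, J e * ((gibbsMean b J fun σ => edgeSpin σ e) - Real.tanh (b * J e))
        ∂(disorderMeasure α N) := by
  rw [← integral_mul_cavity]
  set F : (Edge N → ℝ) → ℝ := fun J =>
    J e * ((gibbsMean b J fun σ => edgeSpin σ e) - Real.tanh (b * J e)) with hF
  have hi : Integrable F (disorderMeasure α N) := integrable_drift hα₁ hα₂ hN b e
  have hp := measurePreserving_flipEdge (α := α) e
  have hflip : ∫ J, F (flipEdge e J) ∂(disorderMeasure α N) = ∫ J, F J ∂(disorderMeasure α N) := by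
    have hi' := hi.aestronglyMeasurable
    rw [← hp.map_eq] at hi'
    rw [← integral_map hp.measurable.aemeasurable hi', hp.map_eq]
  have hif : Integrable (fun J => F (flipEdge e J)) (disorderMeasure α N) :=
    (hp.integrable_comp hi.aestronglyMeasurable).2 hi
  have hG : Integrable (fun J : Edge N → ℝ => |J e * Real.tanh (b * J e)| *
      (gibbsMean b (Function.update J e 0) fun σ => edgeSpin σ e) ^ 2) (disorderMeasure α N) := by
    have h1 := integrable_coord_mul hα₁ hα₂ hN (C := 1)
      (f := fun J => Real.tanh (b * J e) *
        (gibbsMean b (Function.update J e 0) fun σ => edgeSpin σ e) ^ 2)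
      ((continuous_tanh_coord b e).measurable.mul ((measurable_cavity b e _).pow_const 2))
      (fun J => by
        refine (abs_mul_le_of_abs_le_one (Real.abs_tanh_lt_one _).le).trans ?_
        rw [abs_of_nonneg (sq_nonneg _)]
        exact (sq_le_one_iff_abs_le_one _).2 (abs_gibbsMean_edgeSpin_le _ _ _)) e
    refine h1.abs.congr (Eventually.of_forall fun J => ?_)
    simp only [abs_mul, abs_pow, sq_abs]
    ring
  have h := integral_mono (hG.const_mul 2).neg (hi.fun_add hif) fun J => drift_add_flip_ge b J e
  rw [integral_add hi hif, hflip] at h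
  have h2 : ∫ J : Edge N → ℝ, (-fun J : Edge N → ℝ => 2 * (|J e * Real.tanh (b * J e)| *
      (gibbsMean b (Function.update J e 0) fun σ => edgeSpin σ e) ^ 2)) J ∂(disorderMeasure α N)
      = -(2 * ∫ J : Edge N → ℝ, |J e * Real.tanh (b * J e)| *
      (gibbsMean b (Function.update J e 0) fun σ => edgeSpin σ e) ^ 2 ∂(disorderMeasure α N)) := by
    rw [integral_neg', integral_const_mul]
  rw [h2] at h
  linarith

theorem integrable_mean_sq (b : ℝ) (e : Edge N) : Integrable
    (fun J : Edge N → ℝ => (gibbsMean b J fun σ => edgeSpin σ e) ^ 2) (disorderMeasure α N) :=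
  integrable_of_measurable_bound ((continuous_gibbsMean b _).measurable.pow_const 2) (C := 1)
    fun J => by
      rw [abs_of_nonneg (sq_nonneg _)]
      exact (sq_le_one_iff_abs_le_one _).2 (abs_gibbsMean_edgeSpin_le _ _ _)

theorem integrable_cavity_sq (b : ℝ) (e : Edge N) : Integrable
    (fun J : Edge N → ℝ => (gibbsMean b (Function.update J e 0) fun σ => edgeSpin σ e) ^ 2)
    (disorderMeasure α N) :=
  integrable_of_measurable_bound ((measurable_cavity b e _).pow_const 2) (C := 1)
    fun J => by
      rw [abs_of_nonneg (sq_nonneg _)]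
      exact (sq_le_one_iff_abs_le_one _).2 (abs_gibbsMean_edgeSpin_le _ _ _)

theorem integral_cavity_sq_le (hα₁ : 1 < α) (hα₂ : α < 2) (hN : 0 < N) {b β : ℝ} (hb : 0 ≤ b)
    (hbβ : b ≤ β) (e : Edge N) :
    ∫ J : Edge N → ℝ, (gibbsMean b (Function.update J e 0) fun σ => edgeSpin σ e) ^ 2
        ∂(disorderMeasure α N)
      ≤ 2 * (∫ J : Edge N → ℝ, (gibbsMean b J fun σ => edgeSpin σ e) ^ 2 ∂(disorderMeasure α N))
        + 32 * (tanhConst α β / N) := by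
  have ht := integrable_coord_of_integrable (integrable_tanh_sq (α := α) (N := N) b) e
  have h := integral_mono (integrable_cavity_sq (α := α) b e)
    (((integrable_mean_sq (α := α) b e).const_mul 2).fun_add (ht.const_mul 32)) fun J => by
      have h1 := abs_gibbsMean_sub_update_le b J e fun σ => (abs_edgeSpin σ e).le
      have h2 := abs_sub_abs_le_abs_sub
        (gibbsMean b (Function.update J e 0) fun σ => edgeSpin σ e)
        (gibbsMean b J fun σ => edgeSpin σ e)
      rw [abs_sub_comm] at h2
      have h3 := pow_le_pow_left₀ (abs_nonneg _) (sub_le_iff_le_add.1 (h2.trans h1)) 2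
      simp only
      rw [sq_abs] at h3
      rw [← sq_abs (gibbsMean b J _), ← sq_abs (Real.tanh _)]
      nlinarith [sq_nonneg (4 * |Real.tanh (b * J e)| - |gibbsMean b J fun σ => edgeSpin σ e|)]
  rw [integral_add ((integrable_mean_sq (α := α) b e).const_mul 2) (ht.const_mul 32),
    integral_const_mul, integral_const_mul,
    integral_coord (integrable_tanh_sq b).aestronglyMeasurable] at h
  have := integral_tanh_sq_le_of_le hα₁ hα₂ hN hb hbβ
  linarith

theorem sum_edge_const_le {C : ℝ} (hC : 0 ≤ C) : ∑ _e : Edge N, C ≤ (N : ℝ) ^ 2 * C := by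
  refine (sum_edge_le_sum_pair (N := N) (fun _ => C) fun _ => hC).trans (le_of_eq ?_)
  simp [sq, mul_assoc]

theorem sum_integral_mean_sq_le (hN : 0 < N) (b : ℝ) :
    ∑ e : Edge N, ∫ J : Edge N → ℝ, (gibbsMean b J fun σ => edgeSpin σ e) ^ 2
      ∂(disorderMeasure α N) ≤ (N : ℝ) ^ 2 * ∫ J, overlapSq b J ∂(disorderMeasure α N) := by
  rw [← integral_finsetSum _ fun e _ => integrable_mean_sq b e, ← integral_const_mul]
  exact integral_mono (integrable_finsetSum _ fun e _ => integrable_mean_sq b e)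
    ((integrable_overlapSq b).const_mul _) fun J => sum_sq_edge_mean_le b J hN

/-- The reduced free energy decreases at most at the rate of the mean squared overlap. -/
theorem sum_integral_drift_ge (hα₁ : 1 < α) (hα₂ : α < 2) (hN : 0 < N) {b β : ℝ} (hb : 0 ≤ b)
    (hbβ : b ≤ β) :
    -(2 * driftConst α β * N * (∫ J, overlapSq b J ∂(disorderMeasure α N))
        + 32 * driftConst α β * tanhConst α β)
      ≤ ∑ e, ∫ J : Edge N → ℝ,
        J e * ((gibbsMean b J fun σ => edgeSpin σ e) - Real.tanh (b * J e))
        ∂(disorderMeasure α N) := by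
  have hN' : (0 : ℝ) < N := by exact_mod_cast hN
  have hB := driftConst_nonneg (α := α) (by linarith) (hb.trans hbβ)
  have hc := tanhConst_nonneg (α := α) (by linarith) β
  have h1 : ∀ e : Edge N, (∫ x, |x * Real.tanh (b * x)| ∂(disorderLaw α N)) * (∫ J : Edge N → ℝ,
        (gibbsMean b (Function.update J e 0) fun σ => edgeSpin σ e) ^ 2 ∂(disorderMeasure α N))
      ≤ driftConst α β / N * (2 * (∫ J : Edge N → ℝ, (gibbsMean b J fun σ => edgeSpin σ e) ^ 2
        ∂(disorderMeasure α N)) + 32 * (tanhConst α β / N)) := fun e =>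
    mul_le_mul (integral_abs_mul_tanh_le_of_le hα₁ hα₂ hN hb hbβ)
      (integral_cavity_sq_le hα₁ hα₂ hN hb hbβ e) (integral_nonneg fun _ => sq_nonneg _)
      (by positivity)
  have h2 := Finset.sum_le_sum fun (e : Edge N) (_ : e ∈ Finset.univ) => h1 e
  rw [← Finset.mul_sum, ← Finset.mul_sum, Finset.sum_add_distrib, ← Finset.mul_sum] at h2
  have h3 := sum_edge_const_le (N := N) (C := 32 * (tanhConst α β / N)) (by positivity)
  have h4 := sum_integral_mean_sq_le (α := α) hN b
  have h5 : driftConst α β / N * (2 * (∑ e : Edge N, ∫ J : Edge N → ℝ,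
        (gibbsMean b J fun σ => edgeSpin σ e) ^ 2 ∂(disorderMeasure α N))
        + ∑ _e : Edge N, 32 * (tanhConst α β / N))
      ≤ driftConst α β / N * (2 * ((N : ℝ) ^ 2 * ∫ J, overlapSq b J ∂(disorderMeasure α N))
        + (N : ℝ) ^ 2 * (32 * (tanhConst α β / N))) := by gcongr
  have h6 : driftConst α β / N * (2 * ((N : ℝ) ^ 2 * ∫ J, overlapSq b J ∂(disorderMeasure α N))
        + (N : ℝ) ^ 2 * (32 * (tanhConst α β / N)))
      = 2 * driftConst α β * N * (∫ J, overlapSq b J ∂(disorderMeasure α N))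
        + 32 * driftConst α β * tanhConst α β := by
    field_simp
  have h7 := Finset.sum_le_sum fun (e : Edge N) (_ : e ∈ Finset.univ) =>
    integral_drift_ge hα₁ hα₂ hN b e
  rw [Finset.sum_neg_distrib, ← Finset.mul_sum] at h7
  linarith

/-- The exponential rate in the Grönwall argument. -/
def growthRate (α β : ℝ) : ℝ := 8 * driftConst α β / (1 - tanhConst α β)

theorem neg_integral_logReduced_le (hα₁ : 1 < α) (hα₂ : α < 2) (hN : 0 < N) {β : ℝ}
    (hβ : 0 ≤ β) (hc : tanhConst α β < 1) :
    -(∫ J, logReduced β J ∂(disorderMeasure α N)) + Real.log (2 * N + 1) / 2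
      ≤ Real.exp (growthRate α β * β) *
        (Real.log (2 * N + 1) / 2 + 32 * driftConst α β * tanhConst α β * β) := by
  have hN' : (0 : ℝ) < N := by exact_mod_cast hN
  have hδ : 0 < 1 - tanhConst α β := by linarith
  have hB := driftConst_nonneg (α := α) (by linarith) hβ
  have hc0 := tanhConst_nonneg (α := α) (by linarith) β
  set κ := growthRate α β with hκ
  have hκ0 : 0 ≤ κ := by rw [hκ, growthRate]; positivity
  set L := Real.log (2 * N + 1)
  set A := 32 * driftConst α β * tanhConst α β with hA
  have hA0 : 0 ≤ A := by positivity
  let G : ℝ → ℝ := fun b => ∫ J, logReduced b J ∂(disorderMeasure α N)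
  let G' : ℝ → ℝ := fun b => ∑ e, ∫ J : Edge N → ℝ,
    J e * ((gibbsMean b J fun σ => edgeSpin σ e) - Real.tanh (b * J e)) ∂(disorderMeasure α N)
  have hG : ∀ b, HasDerivAt G (G' b) b := hasDerivAt_integral_logReduced hα₁ hα₂ hN
  let φ : ℝ → ℝ := fun b => Real.exp (-(κ * b)) * (-G b + L / 2) - A * b
  have hφ : ∀ b, HasDerivAt φ
      (Real.exp (-(κ * b)) * (-(κ * 1)) * (-G b + L / 2) + Real.exp (-(κ * b)) * (-G' b) - A * 1) b :=
    fun b => ((((hasDerivAt_id b).const_mul κ).neg.exp).mul ((hG b).neg.add_const (L / 2))).sub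
      ((hasDerivAt_id b).const_mul A)
  have hanti : AntitoneOn φ (Set.Icc 0 β) := by
    refine antitoneOn_of_deriv_nonpos (convex_Icc 0 β)
      (fun b _ => (hφ b).continuousAt.continuousWithinAt)
      (fun b _ => (hφ b).differentiableAt.differentiableWithinAt) fun b hb => ?_
    rw [interior_Icc] at hb
    rw [(hφ b).deriv]
    have h1 := sum_integral_drift_ge (α := α) hα₁ hα₂ hN hb.1.le hb.2.le
    have h2 := integral_overlapSq_add_le (α := α) hα₁ hα₂ hN hb.1.le hb.2.le
    have h3 : 2 * driftConst α β * N * (∫ J, overlapSq b J ∂(disorderMeasure α N))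
        ≤ κ * (-G b + L / 2) := by
      have h4 := mul_le_mul_of_nonneg_left h2 (by positivity : 0 ≤ 4 * driftConst α β / (1 - tanhConst α β))
      have h5 : 4 * driftConst α β / (1 - tanhConst α β) *
          ((1 - tanhConst α β) / 2 * N * (∫ J, overlapSq b J ∂(disorderMeasure α N))
          + 2 * (∫ J, logReduced b J ∂(disorderMeasure α N)))
          = 2 * driftConst α β * N * (∫ J, overlapSq b J ∂(disorderMeasure α N)) + κ * G b := by
        rw [hκ, growthRate]
        field_simp
        ring
      have h6 : 4 * driftConst α β / (1 - tanhConst α β) * L = κ * (L / 2) := by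
        rw [hκ, growthRate]; ring
      rw [h5] at h4
      change _ ≤ 4 * driftConst α β / (1 - tanhConst α β) * L at h4
      linarith
    have h7 : -G' b ≤ κ * (-G b + L / 2) + A := by
      change _ ≤ G' b at h1
      linarith
    have h8 := mul_le_mul_of_nonneg_left h7 (Real.exp_pos (-(κ * b))).le
    have h9 : Real.exp (-(κ * b)) ≤ 1 := by
      rw [Real.exp_le_one_iff]
      have := mul_nonneg hκ0 hb.1.le
      linarith
    have h10 := mul_le_mul_of_nonneg_right h9 hA0
    linarith
  have h := hanti (Set.left_mem_Icc.2 hβ) (Set.right_mem_Icc.2 hβ) hβ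
  have h0 : φ 0 = L / 2 := by
    simp [φ, G, logReduced_zero]
  rw [h0] at h
  simp only [φ] at h
  have h11 : Real.exp (-(κ * β)) * (-G β + L / 2) ≤ L / 2 + A * β := by linarith
  have h12 := mul_le_mul_of_nonneg_left h11 (Real.exp_pos (κ * β)).le
  rwa [← mul_assoc, ← Real.exp_add, add_neg_cancel, Real.exp_zero, one_mul] at h12

theorem integral_overlapSq_le (hα₁ : 1 < α) (hα₂ : α < 2) (hN : 0 < N) {β : ℝ}
    (hβ : 0 ≤ β) (hc : tanhConst α β < 1) :
    ∫ J, overlapSq β J ∂(disorderMeasure α N)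
      ≤ 4 * Real.exp (growthRate α β * β) / (1 - tanhConst α β) *
        ((Real.log (2 * N + 1) / 2 + 32 * driftConst α β * tanhConst α β * β) / N) := by
  have hN' : (0 : ℝ) < N := by exact_mod_cast hN
  have hδ : 0 < 1 - tanhConst α β := by linarith
  have h1 := neg_integral_logReduced_le (α := α) hα₁ hα₂ hN hβ hc
  have h2 := integral_overlapSq_add_le (α := α) hα₁ hα₂ hN hβ le_rfl
  set E := Real.exp (growthRate α β * β) *
        (Real.log (2 * N + 1) / 2 + 32 * driftConst α β * tanhConst α β * β) with hE
  have h3 : (1 - tanhConst α β) / 2 * N * (∫ J, overlapSq β J ∂(disorderMeasure α N)) ≤ 2 * E := by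
    linarith
  have h4 : 4 * Real.exp (growthRate α β * β) / (1 - tanhConst α β) *
        ((Real.log (2 * N + 1) / 2 + 32 * driftConst α β * tanhConst α β * β) / N)
      = 2 * E / ((1 - tanhConst α β) / 2 * N) := by
    rw [hE]; field_simp; ring
  rw [h4, le_div_iff₀ (by positivity)]
  linarith

end Drift

theorem tendsto_log_add_div (A : ℝ) :
    Tendsto (fun N : ℕ => (Real.log (2 * N + 1) / 2 + A) / N) atTop (𝓝 0) := by
  have h1 : Tendsto (fun N : ℕ => (2 * (N : ℝ) + 1)) atTop atTop :=
    tendsto_atTop_add_const_right _ _ (tendsto_natCast_atTop_atTop.const_mul_atTop two_pos)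
  have h2 := (Real.isLittleO_log_id_atTop.tendsto_div_nhds_zero).comp h1
  have h3 : Tendsto (fun N : ℕ => (1 : ℝ) / N) atTop (𝓝 0) := tendsto_one_div_atTop_nhds_zero_nat
  have h4 := (h2.mul ((h3.const_mul (1 / 2)).const_add 1)).add (h3.const_mul A)
  simp only [mul_zero, add_zero, zero_mul] at h4
  refine h4.congr' ?_
  filter_upwards [eventually_gt_atTop 0] with N hN
  have hN' : (0 : ℝ) < N := by exact_mod_cast hN
  simp only [Function.comp, id]
  field_simp

/-! ### The bond overlap at fixed disorder -/

section Bond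

variable {N : ℕ}

/-- The indicator of a heavy coupling. -/
def heavy (K x : ℝ) : ℝ := (Set.Ici K).indicator (fun _ => 1) |x|

theorem heavy_eq_zero_or_one (K x : ℝ) : heavy K x = 0 ∨ heavy K x = 1 := by
  by_cases h : K ≤ |x| <;> simp [heavy, Set.indicator, h]

theorem heavy_nonneg (K x : ℝ) : 0 ≤ heavy K x := by
  rcases heavy_eq_zero_or_one K x with h | h <;> simp [h]

theorem heavy_le_one (K x : ℝ) : heavy K x ≤ 1 := by
  rcases heavy_eq_zero_or_one K x with h | h <;> simp [h]

theorem heavy_mul_self (K x : ℝ) : heavy K x * heavy K x = heavy K x := by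
  rcases heavy_eq_zero_or_one K x with h | h <;> simp [h]

theorem measurable_heavy (K : ℝ) : Measurable (heavy K) :=
  (measurable_const.indicator measurableSet_Ici).comp measurable_id.abs

theorem heavyCount_cast (K : ℝ) (J : Edge N → ℝ) :
    (heavyCount K J : ℝ) = ∑ e, heavy K (J e) := by
  rw [heavyCount, Nat.cast_sum]
  refine Finset.sum_congr rfl fun e _ => ?_
  by_cases h : K ≤ |J e| <;> simp [heavy, h]

theorem bondOverlap_eq (K : ℝ) (J : Edge N → ℝ) (σ τ : Config N) :
    bondOverlap K J σ τ = 1 / (∑ e, heavy K (J e)) *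
      ∑ e, heavy K (J e) * (edgeSpin σ e * edgeSpin τ e) := by
  have hS : ∑ e, heavy K (J e) * (edgeSpin σ e * edgeSpin τ e) = ∑ e : Edge N,
      open Classical in
      if K ≤ |J e| then spin σ e.1.1 * spin σ e.1.2 * spin τ e.1.1 * spin τ e.1.2 else 0 := by
    refine Finset.sum_congr rfl fun e _ => ?_
    by_cases h : K ≤ |J e| <;> simp [heavy, h, edgeSpin, mul_assoc]
  rw [hS, ← heavyCount_cast, bondOverlap]
  split_ifs with h
  · rfl
  · have : heavyCount K J = 0 := by omega
    simp [this]

theorem abs_sum_heavy_mul_le (K : ℝ) (J : Edge N → ℝ) (σ τ : Config N) :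
    |∑ e, heavy K (J e) * (edgeSpin σ e * edgeSpin τ e)| ≤ ∑ e, heavy K (J e) := by
  refine (Finset.abs_sum_le_sum_abs _ _).trans (le_of_eq ?_)
  refine Finset.sum_congr rfl fun e _ => ?_
  rw [abs_mul, abs_mul, abs_edgeSpin, abs_edgeSpin, abs_of_nonneg (heavy_nonneg _ _)]
  ring

theorem abs_bondOverlap_le (K : ℝ) (J : Edge N → ℝ) (σ τ : Config N) :
    |bondOverlap K J σ τ| ≤ 1 := by
  have h0 : 0 ≤ ∑ e, heavy K (J e) := Finset.sum_nonneg fun e _ => heavy_nonneg K _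
  rw [bondOverlap_eq, abs_mul, abs_of_nonneg (by positivity), one_div, ← div_eq_inv_mul]
  exact div_le_one_of_le₀ (abs_sum_heavy_mul_le K J σ τ) h0

theorem sq_bondOverlap_sub_le (K q : ℝ) (J : Edge N → ℝ) (σ τ : Config N) {d m : ℝ} (hd : 0 < d)
    (hm : 2 * d ≤ m) :
    (bondOverlap K J σ τ - q) ^ 2
      ≤ (1 / d ^ 2) * (∑ e, heavy K (J e) * (edgeSpin σ e * edgeSpin τ e - q)) ^ 2
        + (1 / d ^ 2) * ((1 + |q|) ^ 2 * (∑ e, heavy K (J e) - m) ^ 2) := by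
  set M := ∑ e, heavy K (J e) with hM
  rcases le_or_gt d M with h | h
  · have hM0 : 0 < M := hd.trans_le h
    have h1 : (bondOverlap K J σ τ - q) ^ 2
        = (1 / M ^ 2) * (∑ e, heavy K (J e) * (edgeSpin σ e * edgeSpin τ e - q)) ^ 2 := by
      simp only [mul_sub, Finset.sum_sub_distrib, ← Finset.sum_mul]
      rw [bondOverlap_eq, ← hM]
      field_simp
    rw [h1]
    have h2 : 1 / M ^ 2 ≤ 1 / d ^ 2 :=
      one_div_le_one_div_of_le (by positivity) (pow_le_pow_left₀ hd.le h 2)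
    have h3 := mul_le_mul_of_nonneg_right h2
      (sq_nonneg (∑ e, heavy K (J e) * (edgeSpin σ e * edgeSpin τ e - q)))
    have h4 : 0 ≤ (1 / d ^ 2) * ((1 + |q|) ^ 2 * (M - m) ^ 2) := by positivity
    linarith
  · have h1 : (bondOverlap K J σ τ - q) ^ 2 ≤ (1 + |q|) ^ 2 := by
      rw [← sq_abs]
      refine pow_le_pow_left₀ (abs_nonneg _) ((abs_sub _ _).trans ?_) 2
      linarith [abs_bondOverlap_le K J σ τ]
    have h2 : d ^ 2 ≤ (M - m) ^ 2 := by
      have : d ≤ m - M := by linarith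
      nlinarith
    have h3 : (1 + |q|) ^ 2 ≤ (1 / d ^ 2) * ((1 + |q|) ^ 2 * (M - m) ^ 2) := by
      rw [one_div, ← div_eq_inv_mul, le_div_iff₀ (by positivity)]
      exact mul_le_mul_of_nonneg_left h2 (by positivity)
    have h4 : 0 ≤ (1 / d ^ 2) *
        (∑ e, heavy K (J e) * (edgeSpin σ e * edgeSpin τ e - q)) ^ 2 := by positivity
    linarith

/-- The Gibbs mean of `(σ¹_e σ²_e - q)(σ¹_{e'} σ²_{e'} - q)`. -/
def pairCov (β q : ℝ) (J : Edge N → ℝ) (e e' : Edge N) : ℝ :=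
  (gibbsMean β J fun σ => edgeSpin σ e * edgeSpin σ e') ^ 2
    - q * (gibbsMean β J fun σ => edgeSpin σ e) ^ 2
    - q * (gibbsMean β J fun σ => edgeSpin σ e') ^ 2 + q ^ 2

theorem gibbsExp_pairCov (β q : ℝ) (J : Edge N → ℝ) (e e' : Edge N) :
    gibbsExp β J (fun τ : Fin 2 → Config N => (edgeSpin (τ 0) e * edgeSpin (τ 1) e - q) *
      (edgeSpin (τ 0) e' * edgeSpin (τ 1) e' - q)) = pairCov β q J e e' := by
  have h : ∀ τ : Fin 2 → Config N, (edgeSpin (τ 0) e * edgeSpin (τ 1) e - q) *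
      (edgeSpin (τ 0) e' * edgeSpin (τ 1) e' - q)
      = (edgeSpin (τ 0) e * edgeSpin (τ 0) e') * (edgeSpin (τ 1) e * edgeSpin (τ 1) e')
        + ((-q) * (edgeSpin (τ 0) e * edgeSpin (τ 1) e)
        + ((-q) * (edgeSpin (τ 0) e' * edgeSpin (τ 1) e') + q ^ 2 * 1)) := fun τ => by ring
  simp only [h]
  rw [gibbsExp_add, gibbsExp_add, gibbsExp_add, gibbsExp_const_mul, gibbsExp_const_mul,
    gibbsExp_const_mul, gibbsExp_one,
    gibbsExp_two_mul β J (fun σ => edgeSpin σ e * edgeSpin σ e')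
      (fun σ => edgeSpin σ e * edgeSpin σ e'),
    gibbsExp_two_mul β J (fun σ => edgeSpin σ e) (fun σ => edgeSpin σ e),
    gibbsExp_two_mul β J (fun σ => edgeSpin σ e') (fun σ => edgeSpin σ e'), pairCov]
  ring

theorem gibbsExp_sq_bondOverlap_sub_le (β K q : ℝ) (J : Edge N → ℝ) {d m : ℝ} (hd : 0 < d)
    (hm : 2 * d ≤ m) :
    gibbsExp β J (fun τ : Fin 2 → Config N => (bondOverlap K J (τ 0) (τ 1) - q) ^ 2)
      ≤ (1 / d ^ 2) * (∑ e, ∑ e', heavy K (J e) * heavy K (J e') * pairCov β q J e e')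
        + (1 / d ^ 2) * ((1 + |q|) ^ 2 * (∑ e, heavy K (J e) - m) ^ 2) := by
  refine (gibbsExp_mono β J fun τ => sq_bondOverlap_sub_le K q J (τ 0) (τ 1) hd hm).trans
    (le_of_eq ?_)
  have h : ∀ τ : Fin 2 → Config N,
      (∑ e, heavy K (J e) * (edgeSpin (τ 0) e * edgeSpin (τ 1) e - q)) ^ 2
      = ∑ e, ∑ e', (heavy K (J e) * heavy K (J e')) *
        ((edgeSpin (τ 0) e * edgeSpin (τ 1) e - q) *
          (edgeSpin (τ 0) e' * edgeSpin (τ 1) e' - q)) := fun τ => by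
    rw [sq, Finset.sum_mul_sum]
    exact Finset.sum_congr rfl fun e _ => Finset.sum_congr rfl fun e' _ => by ring
  have hc : ∀ c : ℝ, gibbsExp β J (fun _ : Fin 2 → Config N => c) = c := fun c => by
    have := gibbsExp_const_mul (n := 2) β J c fun _ => 1
    rwa [gibbsExp_one, mul_one] at this
  rw [gibbsExp_add, hc, gibbsExp_const_mul]
  simp only [h]
  rw [gibbsExp_sum]
  congr 2
  refine Finset.sum_congr rfl fun e _ => ?_
  rw [gibbsExp_sum]
  refine Finset.sum_congr rfl fun e' _ => ?_
  rw [gibbsExp_const_mul, gibbsExp_pairCov]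

theorem abs_pairCov_le (β q : ℝ) (J : Edge N → ℝ) (e e' : Edge N) :
    |pairCov β q J e e'| ≤ (1 + |q|) ^ 2 := by
  have h1 := (sq_le_one_iff_abs_le_one _).2 (abs_gibbsMean_edgeSpin_le β J e)
  have h2 := (sq_le_one_iff_abs_le_one _).2 (abs_gibbsMean_edgeSpin_le β J e')
  have h3 := (sq_le_one_iff_abs_le_one _).2 (abs_gibbsMean_edgeSpin_mul_le β J e e')
  unfold pairCov
  set x := (gibbsMean β J fun σ => edgeSpin σ e) ^ 2 with hx
  set y := (gibbsMean β J fun σ => edgeSpin σ e') ^ 2 with hy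
  set z := (gibbsMean β J fun σ => edgeSpin σ e * edgeSpin σ e') ^ 2 with hz
  have hx0 : 0 ≤ x := sq_nonneg _
  have hy0 : 0 ≤ y := sq_nonneg _
  have hz0 : 0 ≤ z := sq_nonneg _
  have k1 : |q * x| ≤ |q| := by
    rw [abs_mul, abs_of_nonneg hx0]; exact mul_le_of_le_one_right (abs_nonneg q) h1
  have k2 : |q * y| ≤ |q| := by
    rw [abs_mul, abs_of_nonneg hy0]; exact mul_le_of_le_one_right (abs_nonneg q) h2
  have k3 : (1 + |q|) ^ 2 = 1 + 2 * |q| + q ^ 2 := by rw [add_sq, sq_abs]; ring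
  have k4 := abs_le.1 k1
  have k5 := abs_le.1 k2
  rw [k3, abs_le]
  constructor <;> nlinarith [sq_nonneg q]

end Bond

/-! ### Averaging the bond overlap over the disorder -/

theorem integral_heavy_law {α : ℝ} {N : ℕ} (hα : 0 < α) (hN : 0 < N) {K : ℝ} (hK : (N : ℝ) ^ (-1 / α) ≤ K) :
    ∫ x, heavy K x ∂(disorderLaw α N) = K ^ (-α) / N :=
  integral_heavy_one hα hN hK

section BondMean

variable {α : ℝ} {N : ℕ} [IsProbabilityMeasure (disorderLaw α N)]

theorem measurable_heavy_coord (K : ℝ) (e : Edge N) :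
    Measurable fun J : Edge N → ℝ => heavy K (J e) :=
  (measurable_heavy K).comp (measurable_pi_apply e)

theorem measurable_pairCov (β q : ℝ) (e e' : Edge N) :
    Measurable fun J : Edge N → ℝ => pairCov β q J e e' := by
  have h1 := (continuous_gibbsMean (N := N) β fun σ => edgeSpin σ e).measurable
  have h2 := (continuous_gibbsMean (N := N) β fun σ => edgeSpin σ e').measurable
  have h3 := (continuous_gibbsMean (N := N) β fun σ => edgeSpin σ e * edgeSpin σ e').measurable
  unfold pairCov
  fun_prop

theorem measurable_pairError (β : ℝ) (e e' : Edge N) :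
    Measurable fun J : Edge N → ℝ => pairError β J e e' := by
  have hd : Continuous fun J : Edge N → ℝ => deletePair J e e' :=
    (continuous_id.update e continuous_const).update e' continuous_const
  have h : ∀ f, Measurable fun J : Edge N → ℝ => gibbsMean β (deletePair J e e') f := fun f =>
    ((continuous_gibbsMean β f).comp hd).measurable
  unfold pairError
  exact ((h _).abs.add (h _).abs).add (h _).abs

theorem pairError_le_three (β : ℝ) (J : Edge N → ℝ) (e e' : Edge N) : pairError β J e e' ≤ 3 := by
  unfold pairError
  linarith [abs_gibbsMean_edgeSpin_le β (deletePair J e e') e,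
    abs_gibbsMean_edgeSpin_le β (deletePair J e e') e',
    abs_gibbsMean_edgeSpin_mul_le β (deletePair J e e') e e']

theorem deletePair_congr {J J' : Edge N → ℝ} {e e' : Edge N}
    (h : ∀ f ∈ ({e, e'}ᶜ : Finset (Edge N)), J f = J' f) : deletePair J e e' = deletePair J' e e' := by
  funext f
  by_cases h1 : f = e'
  · subst h1; simp [deletePair]
  by_cases h2 : f = e
  · subst h2; simp [deletePair, Function.update_of_ne h1]
  · simp only [deletePair, Function.update_of_ne h1, Function.update_of_ne h2]
    exact h f (by simp [h1, h2])

theorem integrable_heavy_law (K : ℝ) : Integrable (heavy K) (disorderLaw α N) :=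
  integrable_of_measurable_bound (measurable_heavy K) (C := 1) fun x => by
    rw [abs_of_nonneg (heavy_nonneg K x)]; exact heavy_le_one K x

theorem measurable_heavy_mul (β K q : ℝ) :
    Measurable fun x => heavy K x * (Real.tanh (β * x) ^ 2 - q) :=
  (measurable_heavy K).mul
    (((measurable_tanh.comp (measurable_const_mul β)).pow_const 2).sub_const q)

/-- The value `bondLimit` is the mean of `tanh²(βJ)` over heavy couplings. -/
theorem integral_heavy_mul_centered (hα : 0 < α) {β : ℝ} (hβ : 0 ≤ β) (hN : 0 < N) {K : ℝ}
    (hK : (N : ℝ) ^ (-1 / α) ≤ K) :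
    ∫ x, heavy K x * (Real.tanh (β * x) ^ 2 - bondLimit α β K) ∂(disorderLaw α N) = 0 := by
  have h1 : ∀ x, heavy K x * Real.tanh (β * x) ^ 2
      = (Set.Ici K).indicator (fun y => Real.tanh (β * y) ^ 2) |x| := fun x => by
    have : Real.tanh (β * |x|) ^ 2 = Real.tanh (β * x) ^ 2 := by
      rw [← abs_of_nonneg hβ, ← abs_mul, tanh_abs, sq_abs, abs_of_nonneg hβ]
    by_cases h : K ≤ |x| <;> simp [heavy, h, this]
  have hi : Integrable (fun x => heavy K x * Real.tanh (β * x) ^ 2) (disorderLaw α N) :=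
    integrable_of_measurable_bound (by simpa using measurable_heavy_mul β K 0) (C := 1) fun x => by
      rw [abs_of_nonneg (mul_nonneg (heavy_nonneg K x) (sq_nonneg _))]
      exact mul_le_one₀ (heavy_le_one K x) (sq_nonneg _) (Real.tanh_sq_lt_one _).le
  simp only [mul_sub]
  rw [integral_sub hi ((integrable_heavy_law K).mul_const _), integral_mul_const,
    integral_heavy_law hα hN hK]
  simp only [h1]
  rw [integral_heavy_tanh_sq hα β hN hK, sub_self]

theorem integral_heavy_mul_heavy (hα : 0 < α) (hN : 0 < N) {K : ℝ}
    (hK : (N : ℝ) ^ (-1 / α) ≤ K) {e e' : Edge N} (hee : e' ≠ e) :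
    ∫ J : Edge N → ℝ, heavy K (J e) * heavy K (J e') ∂(disorderMeasure α N)
      = (K ^ (-α) / N) ^ 2 := by
  rw [integral_mul_of_disjoint (S := {e}) (T := {e'}) (by simpa using hee.symm)
    (measurable_heavy_coord K e) (measurable_heavy_coord K e')
    (fun J J' h => by rw [h e (by simp)]) (fun J J' h => by rw [h e' (by simp)]),
    integral_coord (measurable_heavy K).aestronglyMeasurable,
    integral_coord (measurable_heavy K).aestronglyMeasurable, integral_heavy_law hα hN hK, sq]

theorem integral_heavy_pairError (hα : 0 < α) (hN : 0 < N) {K : ℝ}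
    (hK : (N : ℝ) ^ (-1 / α) ≤ K) (β : ℝ) {e e' : Edge N} (hee : e' ≠ e) :
    ∫ J : Edge N → ℝ, (heavy K (J e) * heavy K (J e')) * pairError β J e e' ∂(disorderMeasure α N)
      = (K ^ (-α) / N) ^ 2 * ∫ J, pairError β J e e' ∂(disorderMeasure α N) := by
  rw [integral_mul_of_disjoint (S := {e, e'}) (T := {e, e'}ᶜ) disjoint_compl_right
    (f := fun J => heavy K (J e) * heavy K (J e')) (g := fun J => pairError β J e e')
    ((measurable_heavy_coord K e).mul (measurable_heavy_coord K e')) (measurable_pairError β e e')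
    (fun J J' h => by simp only [h e (by simp), h e' (by simp)])
    (fun J J' h => by simp only [pairError, deletePair_congr h]),
    integral_heavy_mul_heavy hα hN hK hee]

theorem abs_heavy_mul_heavy_le (K : ℝ) (J : Edge N → ℝ) (e e' : Edge N) :
    |heavy K (J e) * heavy K (J e')| ≤ 1 := by
  rw [abs_of_nonneg (mul_nonneg (heavy_nonneg _ _) (heavy_nonneg _ _))]
  exact mul_le_one₀ (heavy_le_one _ _) (heavy_nonneg _ _) (heavy_le_one _ _)

theorem integrable_heavy_mul {f : (Edge N → ℝ) → ℝ} (hf : Measurable f) {C : ℝ}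
    (h : ∀ J, |f J| ≤ C) (K : ℝ) (e e' : Edge N) :
    Integrable (fun J => heavy K (J e) * heavy K (J e') * f J) (disorderMeasure α N) :=
  integrable_of_measurable_bound
    (((measurable_heavy_coord K e).mul (measurable_heavy_coord K e')).mul hf)
    fun J => (abs_mul_le_of_abs_le_one (abs_heavy_mul_heavy_le K J e e')).trans (h J)

theorem integral_heavy_pairCov_le (hα : 0 < α) {β : ℝ} (hβ : 0 ≤ β) (hN : 0 < N) {K : ℝ}
    (hK : (N : ℝ) ^ (-1 / α) ≤ K) {e e' : Edge N} (hee : e' ≠ e) :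
    ∫ J : Edge N → ℝ, heavy K (J e) * heavy K (J e') * pairCov β (bondLimit α β K) J e e'
        ∂(disorderMeasure α N)
      ≤ 8 * (1 + 2 * |bondLimit α β K|) * (K ^ (-α) / N) ^ 2 *
        ∫ J, pairError β J e e' ∂(disorderMeasure α N) := by
  set q := bondLimit α β K with hq
  let T : ℝ → ℝ := fun x => heavy K x * (Real.tanh (β * x) ^ 2 - q)
  have hT : Measurable T := measurable_heavy_mul β K q
  have hTb : ∀ x, |T x| ≤ 1 + |q| := fun x => by
    refine (abs_mul_le_of_abs_le_one ?_).trans ((abs_sub _ _).trans ?_)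
    · rw [abs_of_nonneg (heavy_nonneg K x)]; exact heavy_le_one K x
    · rw [abs_of_nonneg (sq_nonneg _)]
      linarith [Real.tanh_sq_lt_one (β * x)]
  have hTT : ∫ J : Edge N → ℝ, T (J e) * T (J e') ∂(disorderMeasure α N) = 0 := by
    rw [integral_mul_of_disjoint (S := {e}) (T := {e'}) (by simpa using hee.symm)
      (f := fun J => T (J e)) (g := fun J => T (J e'))
      (hT.comp (measurable_pi_apply e)) (hT.comp (measurable_pi_apply e'))
      (fun J J' h => by simp only [h e (by simp)])
      (fun J J' h => by simp only [h e' (by simp)])]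
    have : ∫ J : Edge N → ℝ, T (J e) ∂(disorderMeasure α N) = 0 := by
      refine (integral_coord hT.aestronglyMeasurable e).trans ?_
      exact integral_heavy_mul_centered hα hβ hN hK
    rw [this, zero_mul]
  have hiT : Integrable (fun J : Edge N → ℝ => T (J e) * T (J e')) (disorderMeasure α N) :=
    integrable_of_measurable_bound ((hT.comp (measurable_pi_apply e)).mul
      (hT.comp (measurable_pi_apply e'))) (C := (1 + |q|) * (1 + |q|)) fun J => by
      rw [abs_mul]
      exact mul_le_mul (hTb _) (hTb _) (abs_nonneg _) (by positivity)
  have hiE : Integrable (fun J : Edge N → ℝ => heavy K (J e) * heavy K (J e') * pairError β J e e')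
      (disorderMeasure α N) :=
    integrable_heavy_mul (measurable_pairError β e e') (C := 3) (fun J => by
      rw [abs_of_nonneg (pairError_nonneg β J e e')]
      exact pairError_le_three β J e e') K e e'
  have hpt : ∀ J : Edge N → ℝ, heavy K (J e) * heavy K (J e') * pairCov β q J e e'
      ≤ T (J e) * T (J e') + 8 * (1 + 2 * |q|) *
        (heavy K (J e) * heavy K (J e') * pairError β J e e') := fun J => by
    have h1 := (abs_le.1 (abs_pair_covariance_sub_le β q J hee)).2
    have h2 := mul_le_mul_of_nonneg_left h1
      (mul_nonneg (heavy_nonneg K (J e)) (heavy_nonneg K (J e')))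
    simp only [T, pairCov]
    linarith
  have h := integral_mono (integrable_heavy_mul (α := α) (measurable_pairCov β q e e')
    (fun J => abs_pairCov_le β q J e e') K e e') (hiT.fun_add (hiE.const_mul _)) hpt
  rw [integral_add hiT (hiE.const_mul _), hTT, zero_add, integral_const_mul,
    integral_heavy_pairError hα hN hK β hee] at h
  linarith

theorem integral_heavy_pairCov_self_le (hα : 0 < α) (hN : 0 < N) {K : ℝ}
    (hK : (N : ℝ) ^ (-1 / α) ≤ K) (β q : ℝ) (e : Edge N) :
    ∫ J : Edge N → ℝ, heavy K (J e) * heavy K (J e) * pairCov β q J e e ∂(disorderMeasure α N)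
      ≤ (1 + |q|) ^ 2 * (K ^ (-α) / N) := by
  have hi := integrable_coord_of_integrable (integrable_heavy_law (α := α) (N := N) K) e
  have h := integral_mono (integrable_heavy_mul (α := α) (measurable_pairCov β q e e)
    (fun J => abs_pairCov_le β q J e e) K e e) (hi.const_mul ((1 + |q|) ^ 2)) fun J => by
      simp only [heavy_mul_self]
      rw [mul_comm]
      exact mul_le_mul_of_nonneg_right ((le_abs_self _).trans (abs_pairCov_le β q J e e))
        (heavy_nonneg _ _)
  rwa [integral_const_mul, integral_coord (measurable_heavy K).aestronglyMeasurable,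
    integral_heavy_law hα hN hK] at h

theorem integrable_mean_mul_sq (b : ℝ) (e e' : Edge N) : Integrable
    (fun J : Edge N → ℝ => (gibbsMean b J fun σ => edgeSpin σ e * edgeSpin σ e') ^ 2)
    (disorderMeasure α N) :=
  integrable_of_measurable_bound ((continuous_gibbsMean b _).measurable.pow_const 2) (C := 1)
    fun J => by
      rw [abs_of_nonneg (sq_nonneg _)]
      exact (sq_le_one_iff_abs_le_one _).2 (abs_gibbsMean_edgeSpin_mul_le _ _ _ _)

theorem integrable_pairError (β : ℝ) (e e' : Edge N) :
    Integrable (fun J : Edge N → ℝ => pairError β J e e') (disorderMeasure α N) :=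
  integrable_of_measurable_bound (measurable_pairError β e e') (C := 3) fun J => by
    rw [abs_of_nonneg (pairError_nonneg β J e e')]
    exact pairError_le_three β J e e'

theorem integral_pairError_le (hα₁ : 1 < α) (hα₂ : α < 2) {β : ℝ} (hβ : 0 ≤ β) (hN : 0 < N)
    {e e' : Edge N} (hee : e' ≠ e) {ε : ℝ} (hε : 0 < ε) :
    ∫ J, pairError β J e e' ∂(disorderMeasure α N) ≤ (27 * ε + 24 * (tanhConst α β / N) / ε)
      + ((∫ J : Edge N → ℝ, (gibbsMean β J fun σ => edgeSpin σ e) ^ 2 ∂(disorderMeasure α N))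
        + (∫ J : Edge N → ℝ, (gibbsMean β J fun σ => edgeSpin σ e') ^ 2 ∂(disorderMeasure α N))
        + ∫ J : Edge N → ℝ, (gibbsMean β J fun σ => edgeSpin σ e * edgeSpin σ e') ^ 2
          ∂(disorderMeasure α N)) / ε := by
  have i1 := integrable_mean_sq (α := α) β e
  have i2 := integrable_mean_sq (α := α) β e'
  have i3 := integrable_mean_mul_sq (α := α) β e e'
  have i4 := (integrable_coord_of_integrable (integrable_tanh_sq (α := α) (N := N) β) e).const_mul 12
  have i5 := (integrable_coord_of_integrable (integrable_tanh_sq (α := α) (N := N) β) e').const_mul 12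
  have h := integral_mono (integrable_pairError (α := α) β e e')
    ((integrable_const (27 * ε)).fun_add
      (((((i1.fun_add i2).fun_add i3).fun_add i4).fun_add i5).div_const ε))
    fun J => pairError_le β J hee hε
  rw [integral_add (integrable_const _)
      (((((i1.fun_add i2).fun_add i3).fun_add i4).fun_add i5).div_const ε), integral_const,
    probReal_univ, one_smul, integral_div,
    integral_add (((i1.fun_add i2).fun_add i3).fun_add i4) i5,
    integral_add ((i1.fun_add i2).fun_add i3) i4, integral_add (i1.fun_add i2) i3,
    integral_add i1 i2, integral_const_mul, integral_const_mul,
    integral_coord (integrable_tanh_sq β).aestronglyMeasurable,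
    integral_coord (integrable_tanh_sq β).aestronglyMeasurable] at h
  have ht := integral_tanh_sq_le_of_le (α := α) hα₁ hα₂ hN hβ le_rfl
  refine h.trans ?_
  rw [add_assoc (27 * ε), ← add_div]
  refine add_le_add le_rfl (div_le_div_of_nonneg_right ?_ hε.le)
  linarith

theorem sum_integral_mean_mul_sq_le (hN : 0 < N) (b : ℝ) :
    ∑ e : Edge N, ∑ e' : Edge N, ∫ J : Edge N → ℝ,
      (gibbsMean b J fun σ => edgeSpin σ e * edgeSpin σ e') ^ 2 ∂(disorderMeasure α N)
      ≤ (N : ℝ) ^ 4 * ∫ J, overlapSq b J ∂(disorderMeasure α N) := by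
  have hi : ∀ e : Edge N, Integrable (fun J : Edge N → ℝ => ∑ e' : Edge N,
      (gibbsMean b J fun σ => edgeSpin σ e * edgeSpin σ e') ^ 2) (disorderMeasure α N) := fun e =>
    integrable_finsetSum _ fun e' _ => integrable_mean_mul_sq b e e'
  have h : ∀ e : Edge N, ∑ e' : Edge N, ∫ J : Edge N → ℝ,
      (gibbsMean b J fun σ => edgeSpin σ e * edgeSpin σ e') ^ 2 ∂(disorderMeasure α N)
      = ∫ J : Edge N → ℝ, ∑ e' : Edge N, (gibbsMean b J fun σ => edgeSpin σ e * edgeSpin σ e') ^ 2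
        ∂(disorderMeasure α N) := fun e =>
    (integral_finsetSum _ fun e' _ => integrable_mean_mul_sq b e e').symm
  simp only [h]
  rw [← integral_finsetSum _ fun e _ => hi e, ← integral_const_mul]
  exact integral_mono (integrable_finsetSum _ fun e _ => hi e)
    ((integrable_overlapSq b).const_mul _) fun J => sum_sq_edge_pair_mean_le b J hN

/-- The bound on the mean of the correlations of pairs of edges. -/
theorem sum_pair_bound_le (hN : 0 < N) {β : ℝ} {ε C : ℝ} (hε : 0 < ε) (hC : 0 ≤ C) :
    ∑ e : Edge N, ∑ e' : Edge N, (C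
      + ((∫ J : Edge N → ℝ, (gibbsMean β J fun σ => edgeSpin σ e) ^ 2 ∂(disorderMeasure α N))
        + (∫ J : Edge N → ℝ, (gibbsMean β J fun σ => edgeSpin σ e') ^ 2 ∂(disorderMeasure α N))
        + ∫ J : Edge N → ℝ, (gibbsMean β J fun σ => edgeSpin σ e * edgeSpin σ e') ^ 2
          ∂(disorderMeasure α N)) / ε)
      ≤ (N : ℝ) ^ 4 * (C + 3 * (∫ J, overlapSq β J ∂(disorderMeasure α N)) / ε) := by
  have h1 := sum_integral_mean_sq_le (α := α) hN β
  have h2 := sum_integral_mean_mul_sq_le (α := α) hN β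
  set O := ∫ J, overlapSq β J ∂(disorderMeasure α N)
  have hO : 0 ≤ O := integral_nonneg fun J => overlapSq_nonneg β J
  have h3 : ∑ _e : Edge N, ∑ _e' : Edge N, C ≤ (N : ℝ) ^ 4 * C := by
    have k1 := sum_edge_const_le (N := N) hC
    refine (sum_edge_const_le (N := N) (Finset.sum_nonneg fun _ _ => hC)).trans ?_
    refine (mul_le_mul_of_nonneg_left k1 (by positivity)).trans (le_of_eq (by ring))
  have hc : ((Fintype.card (Edge N) : ℕ) : ℝ) ≤ (N : ℝ) ^ 2 := by
    have := sum_edge_const_le (N := N) (zero_le_one' ℝ)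
    simpa using this
  simp only [Finset.sum_add_distrib, ← Finset.sum_div] at h3 ⊢
  simp only [Finset.sum_const, Finset.card_univ, nsmul_eq_mul, ← Finset.mul_sum] at h3 ⊢
  set X := ∑ e : Edge N, ∫ J : Edge N → ℝ, (gibbsMean β J fun σ => edgeSpin σ e) ^ 2
    ∂(disorderMeasure α N)
  have hX : (Fintype.card (Edge N) : ℝ) * X ≤ (N : ℝ) ^ 4 * O := by
    calc (Fintype.card (Edge N) : ℝ) * X
        ≤ (N : ℝ) ^ 2 * ((N : ℝ) ^ 2 * O) :=
          mul_le_mul hc h1 (Finset.sum_nonneg fun _ _ => integral_nonneg fun _ => sq_nonneg _)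
            (by positivity)
      _ = (N : ℝ) ^ 4 * O := by ring
  have h4 : ((Fintype.card (Edge N) : ℝ) * X + (Fintype.card (Edge N) : ℝ) * X
      + ∑ e : Edge N, ∑ e' : Edge N, ∫ J : Edge N → ℝ,
        (gibbsMean β J fun σ => edgeSpin σ e * edgeSpin σ e') ^ 2 ∂(disorderMeasure α N)) / ε
      ≤ (3 * ((N : ℝ) ^ 4 * O)) / ε := by
    gcongr
    linarith
  have h5 : (N : ℝ) ^ 4 * (C + 3 * O / ε) = (N : ℝ) ^ 4 * C + (3 * ((N : ℝ) ^ 4 * O)) / ε := by ring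
  rw [h5]
  exact add_le_add h3 h4

end BondMean

section BondBound

variable {α : ℝ} {N : ℕ} [IsProbabilityMeasure (disorderLaw α N)]

theorem sum_integral_heavy_pairCov_le (hα₁ : 1 < α) (hα₂ : α < 2) {β : ℝ} (hβ : 0 ≤ β)
    (hN : 0 < N) {K : ℝ} (hK : (N : ℝ) ^ (-1 / α) ≤ K) {ε : ℝ} (hε : 0 < ε) :
    ∑ e : Edge N, ∑ e' : Edge N, ∫ J : Edge N → ℝ,
        heavy K (J e) * heavy K (J e') * pairCov β (bondLimit α β K) J e e' ∂(disorderMeasure α N)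
      ≤ (N : ℝ) ^ 2 * ((1 + |bondLimit α β K|) ^ 2 * (K ^ (-α) / N))
        + 8 * (1 + 2 * |bondLimit α β K|) * (K ^ (-α) / N) ^ 2 * ((N : ℝ) ^ 4 *
          (27 * ε + 24 * (tanhConst α β / N) / ε
            + 3 * (∫ J, overlapSq β J ∂(disorderMeasure α N)) / ε)) := by
  have hN' : (0 : ℝ) < N := by exact_mod_cast hN
  have hK0 : 0 < K := (Real.rpow_pos_of_pos hN' _).trans_le hK
  have hα : 0 < α := by linarith
  have hc := tanhConst_nonneg hα β
  set q := bondLimit α β K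
  set C := 27 * ε + 24 * (tanhConst α β / N) / ε
  have hC : 0 ≤ C := by positivity
  let D : Edge N → Edge N → ℝ := fun e e' => C
      + ((∫ J : Edge N → ℝ, (gibbsMean β J fun σ => edgeSpin σ e) ^ 2 ∂(disorderMeasure α N))
        + (∫ J : Edge N → ℝ, (gibbsMean β J fun σ => edgeSpin σ e') ^ 2 ∂(disorderMeasure α N))
        + ∫ J : Edge N → ℝ, (gibbsMean β J fun σ => edgeSpin σ e * edgeSpin σ e') ^ 2
          ∂(disorderMeasure α N)) / ε
  have hD : ∀ e e', 0 ≤ D e e' := fun e e' => by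
    have h : ∀ f : (Edge N → ℝ) → ℝ, 0 ≤ ∫ J, f J ^ 2 ∂(disorderMeasure α N) := fun f =>
      integral_nonneg fun _ => sq_nonneg _
    have h1 := h fun J => gibbsMean β J fun σ => edgeSpin σ e
    have h2 := h fun J => gibbsMean β J fun σ => edgeSpin σ e'
    have h3 := h fun J => gibbsMean β J fun σ => edgeSpin σ e * edgeSpin σ e'
    simp only [D]
    positivity
  set W := 8 * (1 + 2 * |q|) * (K ^ (-α) / N) ^ 2
  have hW : 0 ≤ W := by positivity
  set Y := (1 + |q|) ^ 2 * (K ^ (-α) / N)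
  have hY : 0 ≤ Y := by positivity
  have hterm : ∀ e e' : Edge N, ∫ J : Edge N → ℝ,
        heavy K (J e) * heavy K (J e') * pairCov β q J e e' ∂(disorderMeasure α N)
      ≤ (if e = e' then Y else 0) + W * D e e' := fun e e' => by
    by_cases h : e = e'
    · subst h
      have h1 := integral_heavy_pairCov_self_le (α := α) hα hN hK β q e
      have h2 := mul_nonneg hW (hD e e)
      simp only [if_true]
      linarith
    · rw [if_neg h, zero_add]
      refine (integral_heavy_pairCov_le hα hβ hN hK (Ne.symm h)).trans ?_
      exact mul_le_mul_of_nonneg_left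
        (integral_pairError_le hα₁ hα₂ hβ hN (Ne.symm h) hε) hW
  refine (Finset.sum_le_sum fun e _ => Finset.sum_le_sum fun e' _ => hterm e e').trans ?_
  simp only [Finset.sum_add_distrib, ← Finset.mul_sum, Finset.sum_ite_eq, Finset.mem_univ, if_true]
  exact add_le_add (sum_edge_const_le hY)
    (mul_le_mul_of_nonneg_left (sum_pair_bound_le hN hε hC) hW)

theorem integral_sq_heavyCount_sub_le (hα : 0 < α) (hN : 0 < N) {K : ℝ}
    (hK : (N : ℝ) ^ (-1 / α) ≤ K) :
    ∫ J : Edge N → ℝ, (∑ e, heavy K (J e) - ∑ _e : Edge N, K ^ (-α) / N) ^ 2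
      ∂(disorderMeasure α N) ≤ (N : ℝ) ^ 2 * (K ^ (-α) / N) := by
  have hN' : (0 : ℝ) < N := by exact_mod_cast hN
  have hK0 : 0 < K := (Real.rpow_pos_of_pos hN' _).trans_le hK
  set p := K ^ (-α) / N with hp
  have hp0 : 0 ≤ p := by positivity
  let c : Edge N → (Edge N → ℝ) → ℝ := fun e J => heavy K (J e) - p
  have hm : ∀ e, Measurable (c e) := fun e => (measurable_heavy_coord K e).sub_const p
  have hb : ∀ e J, |c e J| ≤ 1 + p := fun e J => by
    refine (abs_sub _ _).trans ?_
    rw [abs_of_nonneg (heavy_nonneg _ _), abs_of_nonneg hp0]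
    linarith [heavy_le_one K (J e)]
  have hi : ∀ e e', Integrable (fun J => c e J * c e' J) (disorderMeasure α N) := fun e e' =>
    integrable_of_measurable_bound ((hm e).mul (hm e')) (C := (1 + p) * (1 + p)) fun J => by
      rw [abs_mul]
      exact mul_le_mul (hb _ _) (hb _ _) (abs_nonneg _) (by positivity)
  have hih := fun e : Edge N => integrable_coord_of_integrable (integrable_heavy_law (α := α) (N := N) K) e
  have hh : ∀ e : Edge N, ∫ J : Edge N → ℝ, heavy K (J e) ∂(disorderMeasure α N) = p := fun e => by
    rw [integral_coord (measurable_heavy K).aestronglyMeasurable, integral_heavy_law hα hN hK]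
  have hc0 : ∀ e, ∫ J, c e J ∂(disorderMeasure α N) = 0 := fun e => by
    simp only [c]
    rw [integral_sub (hih e) (integrable_const _), hh]
    simp
  have hterm : ∀ e e', ∫ J, c e J * c e' J ∂(disorderMeasure α N) ≤ if e = e' then p else 0 := by
    intro e e'
    by_cases h : e = e'
    · subst h
      rw [if_pos rfl]
      have h1 : ∀ J : Edge N → ℝ, c e J * c e J = (1 - 2 * p) * heavy K (J e) + p ^ 2 := fun J => by
        have := heavy_mul_self K (J e)
        simp only [c]
        linear_combination this
      simp only [h1]
      rw [integral_add ((hih e).const_mul _) (integrable_const _), integral_const_mul, hh]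
      simp
      nlinarith [sq_nonneg p]
    · rw [if_neg h, integral_mul_of_disjoint (S := {e}) (T := {e'}) (by simpa using h)
        (hm e) (hm e') (fun J J' h => by simp only [c, h e (by simp)])
        (fun J J' h => by simp only [c, h e' (by simp)]), hc0, zero_mul]
  have hsq : ∀ J : Edge N → ℝ, (∑ e, heavy K (J e) - ∑ _e : Edge N, p) ^ 2
      = ∑ e, ∑ e', c e J * c e' J := fun J => by
    rw [← Finset.sum_sub_distrib, sq, Finset.sum_mul_sum]
  simp only [hsq]
  rw [integral_finsetSum _ fun e _ => integrable_finsetSum _ fun e' _ => hi e e']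
  have h2 : ∀ e, ∫ J, ∑ e', c e J * c e' J ∂(disorderMeasure α N) ≤ p := fun e => by
    rw [integral_finsetSum _ fun e' _ => hi e e']
    refine (Finset.sum_le_sum fun e' _ => hterm e e').trans (le_of_eq ?_)
    simp
  exact (Finset.sum_le_sum fun e _ => h2 e).trans (sum_edge_const_le hp0)

theorem measurable_bondOverlap (K : ℝ) (σ τ : Config N) :
    Measurable fun J : Edge N → ℝ => bondOverlap K J σ τ := by
  simp only [bondOverlap_eq]
  have h := fun e : Edge N => measurable_heavy_coord K e
  fun_prop

theorem measurable_gibbsExp_bond (β K q : ℝ) : Measurable fun J : Edge N → ℝ =>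
    gibbsExp β J fun τ : Fin 2 → Config N => (bondOverlap K J (τ 0) (τ 1) - q) ^ 2 :=
  Finset.measurable_sum _ fun τ _ => Measurable.mul
    (Finset.measurable_prod _ fun l _ => (continuous_gibbsWeight β (τ l)).measurable)
    (((measurable_bondOverlap K (τ 0) (τ 1)).sub_const q).pow_const 2)

theorem card_edge (N : ℕ) : 2 * (Fintype.card (Edge N) : ℝ) + N = (N : ℝ) ^ 2 := by
  have h := two_mul_sum_edge_add (N := N) fun _ => 1
  simpa using h

theorem integral_bond_le (hα₁ : 1 < α) (hα₂ : α < 2) {β : ℝ} (hβ : 0 ≤ β) (hN : 2 ≤ N) {K : ℝ}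
    (hK : (N : ℝ) ^ (-1 / α) ≤ K) {ε : ℝ} (hε : 0 < ε) :
    ∫ J : Edge N → ℝ, gibbsExp β J (fun τ : Fin 2 → Config N =>
        (bondOverlap K J (τ 0) (τ 1) - bondLimit α β K) ^ 2) ∂(disorderMeasure α N)
      ≤ 128 * (1 + |bondLimit α β K|) ^ 2 / K ^ (-α) * (1 / N)
        + 512 * (1 + 2 * |bondLimit α β K|) * (27 * ε + 24 * (tanhConst α β / N) / ε
            + 3 * (∫ J, overlapSq β J ∂(disorderMeasure α N)) / ε) := by
  have hN0 : 0 < N := by omega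
  have hN' : (0 : ℝ) < N := by exact_mod_cast hN0
  have hN2 : (2 : ℝ) ≤ N := by exact_mod_cast hN
  have hK0 : 0 < K := (Real.rpow_pos_of_pos hN' _).trans_le hK
  have hα : 0 < α := by linarith
  have hp : 0 < K ^ (-α) := Real.rpow_pos_of_pos hK0 _
  have h1 := sum_integral_heavy_pairCov_le hα₁ hα₂ hβ hN0 hK hε
  have h2 := integral_sq_heavyCount_sub_le (α := α) hα hN0 hK
  set q := bondLimit α β K
  set R := 27 * ε + 24 * (tanhConst α β / N) / ε
            + 3 * (∫ J, overlapSq β J ∂(disorderMeasure α N)) / ε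
  set p := K ^ (-α)
  set m := ∑ _e : Edge N, p / N with hm
  set d := p * N / 8 with hd
  have hd0 : 0 < d := by positivity
  have hmd : 2 * d ≤ m := by
    rw [hm, hd, Finset.sum_const, nsmul_eq_mul, Finset.card_univ,
      ← mul_div_assoc (Fintype.card (Edge N) : ℝ), le_div_iff₀ hN']
    have h4 : (N : ℝ) ^ 2 / 4 ≤ Fintype.card (Edge N) := by nlinarith [card_edge N]
    linarith [mul_le_mul_of_nonneg_left h4 hp.le]
  have hi1 : ∀ e e' : Edge N, Integrable (fun J : Edge N → ℝ =>
      heavy K (J e) * heavy K (J e') * pairCov β q J e e') (disorderMeasure α N) := fun e e' =>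
    integrable_heavy_mul (measurable_pairCov β q e e') (fun J => abs_pairCov_le β q J e e') K e e'
  have hi1' : ∀ e : Edge N, Integrable (fun J : Edge N → ℝ => ∑ e' : Edge N,
      heavy K (J e) * heavy K (J e') * pairCov β q J e e') (disorderMeasure α N) := fun e =>
    integrable_finsetSum _ fun e' _ => hi1 e e'
  have hi1'' : Integrable (fun J : Edge N → ℝ => ∑ e : Edge N, ∑ e' : Edge N,
      heavy K (J e) * heavy K (J e') * pairCov β q J e e') (disorderMeasure α N) :=
    integrable_finsetSum _ fun e _ => hi1' e
  have hi2 : Integrable (fun J : Edge N → ℝ => (∑ e, heavy K (J e) - m) ^ 2)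
      (disorderMeasure α N) := by
    refine integrable_of_measurable_bound (C := (∑ _e : Edge N, (1 : ℝ) + |m|) ^ 2) ?_ fun J => ?_
    · exact ((Finset.measurable_sum _ fun e _ => measurable_heavy_coord K e).sub_const m).pow_const 2
    · rw [abs_pow]
      refine pow_le_pow_left₀ (abs_nonneg _) ((abs_sub _ _).trans ?_) 2
      rw [abs_of_nonneg (Finset.sum_nonneg fun e _ => heavy_nonneg K (J e))]
      gcongr with e
      exact heavy_le_one K _
  have hi3 : Integrable (fun J : Edge N → ℝ => gibbsExp β J fun τ : Fin 2 → Config N =>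
      (bondOverlap K J (τ 0) (τ 1) - q) ^ 2) (disorderMeasure α N) := by
    refine integrable_of_measurable_bound (measurable_gibbsExp_bond β K q)
      (C := (1 + |q|) ^ 2) fun J => ?_
    rw [abs_of_nonneg (gibbsExp_nonneg β J fun _ => sq_nonneg _)]
    refine gibbsExp_le_of_le β J fun τ => ?_
    rw [← sq_abs]
    refine pow_le_pow_left₀ (abs_nonneg _) ((abs_sub _ _).trans ?_) 2
    linarith [abs_bondOverlap_le K J (τ 0) (τ 1)]
  have h3 := integral_mono hi3
    ((hi1''.const_mul (1 / d ^ 2)).fun_add ((hi2.const_mul ((1 + |q|) ^ 2)).const_mul (1 / d ^ 2)))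
    fun J => gibbsExp_sq_bondOverlap_sub_le β K q J hd0 hmd
  rw [integral_add (hi1''.const_mul (1 / d ^ 2))
    ((hi2.const_mul ((1 + |q|) ^ 2)).const_mul (1 / d ^ 2)), integral_const_mul, integral_const_mul,
    integral_const_mul, integral_finsetSum _ fun e _ => hi1' e] at h3
  simp only [integral_finsetSum _ fun e' _ => hi1 _ e'] at h3
  have h4 := mul_le_mul_of_nonneg_left h1 (by positivity : 0 ≤ 1 / d ^ 2)
  have h5 := mul_le_mul_of_nonneg_left (mul_le_mul_of_nonneg_left h2
    (by positivity : 0 ≤ (1 + |q|) ^ 2)) (by positivity : 0 ≤ 1 / d ^ 2)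
  have h6 : 1 / d ^ 2 * ((N : ℝ) ^ 2 * ((1 + |q|) ^ 2 * (p / N))
        + 8 * (1 + 2 * |q|) * (p / N) ^ 2 * ((N : ℝ) ^ 4 * R))
      + 1 / d ^ 2 * ((1 + |q|) ^ 2 * ((N : ℝ) ^ 2 * (p / N)))
      = 128 * (1 + |q|) ^ 2 / p * (1 / N) + 512 * (1 + 2 * |q|) * R := by
    rw [hd]
    field_simp
    ring
  linarith

end BondBound

/-! ### Transport to the given probability spaces -/

section Transport

variable {α : ℝ} {N : ℕ} {Ω : Type*} [MeasurableSpace Ω] {P : Measure Ω} [IsProbabilityMeasure P]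
  {J : Edge N → Ω → ℝ}

theorem isProbabilityMeasure_disorderLaw (hN : 2 ≤ N)
    (hlaw : ∀ e, HasLaw (J e) (disorderLaw α N) P) : IsProbabilityMeasure (disorderLaw α N) := by
  let e : Edge N := ⟨(⟨0, by omega⟩, ⟨1, by omega⟩), by simp⟩
  rw [← (hlaw e).map_eq]
  exact Measure.isProbabilityMeasure_map (hlaw e).aemeasurable

theorem integral_comp_couplings (hlaw : ∀ e, HasLaw (J e) (disorderLaw α N) P)
    (hindep : iIndepFun J P) {F : (Edge N → ℝ) → ℝ} (hF : Measurable F) :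
    ∫ ω, F (fun e => J e ω) ∂P = ∫ x, F x ∂(disorderMeasure α N) := by
  have hm : ∀ e, AEMeasurable (J e) P := fun e => (hlaw e).aemeasurable
  have h := (iIndepFun_iff_map_fun_eq_pi_map hm).1 hindep
  simp only [(hlaw _).map_eq] at h
  rw [disorderMeasure, ← h]
  exact (integral_map (aemeasurable_pi_lambda _ hm) hF.aestronglyMeasurable).symm

end Transport

theorem tendsto_rpow_neg_div {α : ℝ} (hα : 0 < α) :
    Tendsto (fun N : ℕ => (N : ℝ) ^ (-1 / α)) atTop (𝓝 0) := by
  have h := (tendsto_rpow_neg_atTop (y := 1 / α) (by positivity)).comp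
    (tendsto_natCast_atTop_atTop (R := ℝ))
  simpa [neg_div, Function.comp_def] using h

end LevyModel

end

theorem mainTheorem4
    (α β : ℝ) (hα₁ : 1 < α) (hα₂ : α < 2)
    (hβ₀ : 0 < β) (hβ : β < LevyModel.criticalBeta α)
    {Ω : ℕ → Type*} [∀ N, MeasurableSpace (Ω N)]
    (P : ∀ N, Measure (Ω N)) [∀ N, IsProbabilityMeasure (P N)]
    (J : ∀ N, LevyModel.Edge N → Ω N → ℝ)
    (hlaw : ∀ N e, HasLaw (J N e) (LevyModel.disorderLaw α N) (P N))
    (hindep : ∀ N, iIndepFun (J N) (P N)) :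
    (∀ k : ℕ, 1 ≤ k →
      Tendsto
        (fun N : ℕ => ∫ ω, LevyModel.gibbsExp β (fun e => J N e ω)
          (fun τ : Fin (2 * k) → LevyModel.Config N => LevyModel.siteOverlap τ ^ 2) ∂(P N))
        atTop (𝓝 0)) ∧
    (∀ K : ℝ, 0 < K →
      0 < LevyModel.bondLimit α β K ∧
      Tendsto
        (fun N : ℕ => ∫ ω, LevyModel.gibbsExp β (fun e => J N e ω)
          (fun τ : Fin 2 → LevyModel.Config N =>
            (LevyModel.bondOverlap K (fun e => J N e ω) (τ 0) (τ 1)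
              - LevyModel.bondLimit α β K) ^ 2) ∂(P N))
        atTop (𝓝 0)) := by

  have hα : 0 < α := by linarith
  have hc := LevyModel.tanhConst_lt_one hα₁ hβ₀ hβ
  let r : ℕ → ℝ := fun N => 4 * Real.exp (LevyModel.growthRate α β * β)
    / (1 - LevyModel.tanhConst α β) * ((Real.log (2 * N + 1) / 2
      + 32 * LevyModel.driftConst α β * LevyModel.tanhConst α β * β) / N)
  have hr : Tendsto r atTop (𝓝 0) := by
    simpa using (LevyModel.tendsto_log_add_div
      (32 * LevyModel.driftConst α β * LevyModel.tanhConst α β * β)).const_mul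
        (4 * Real.exp (LevyModel.growthRate α β * β) / (1 - LevyModel.tanhConst α β))
  have hO : ∀ N, 2 ≤ N →
      ∫ x, LevyModel.overlapSq β x ∂(LevyModel.disorderMeasure α N) ≤ r N := fun N hN => by
    have := LevyModel.isProbabilityMeasure_disorderLaw hN (hlaw N)
    exact LevyModel.integral_overlapSq_le hα₁ hα₂ (by omega) hβ₀.le hc
  refine ⟨fun k hk => ?_, fun K hK => ⟨LevyModel.bondLimit_pos hα₁ hα₂ hβ₀ hK, ?_⟩⟩
  · refine squeeze_zero' (Eventually.of_forall fun N => integral_nonneg fun ω =>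
      LevyModel.gibbsExp_nonneg β _ fun τ => sq_nonneg _) ?_ hr
    filter_upwards [eventually_ge_atTop 2] with N hN
    have := LevyModel.isProbabilityMeasure_disorderLaw hN (hlaw N)
    refine le_trans ?_ (hO N hN)
    rw [LevyModel.integral_comp_couplings (hlaw N) (hindep N)
      (F := fun x => LevyModel.gibbsExp β x fun τ : Fin (2 * k) → LevyModel.Config N =>
        LevyModel.siteOverlap τ ^ 2) (LevyModel.continuous_gibbsExp β _).measurable]
    refine integral_mono_of_nonneg (Eventually.of_forall fun x =>
      LevyModel.gibbsExp_nonneg β _ fun τ => sq_nonneg _) (LevyModel.integrable_overlapSq β)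
      (Eventually.of_forall fun x => LevyModel.gibbsExp_siteOverlap_sq_le k hk β x)
  · let s : ℕ → ℝ := fun N => 3 * r N + 24 * LevyModel.tanhConst α β * (1 / N)
    let ε : ℕ → ℝ := fun N => √(s N + 1 / N)
    have hinv : Tendsto (fun N : ℕ => (1 : ℝ) / N) atTop (𝓝 0) :=
      tendsto_one_div_atTop_nhds_zero_nat
    have hs : Tendsto s atTop (𝓝 0) := by
      have h := (hr.const_mul 3).add (hinv.const_mul (24 * LevyModel.tanhConst α β))
      rwa [mul_zero, mul_zero, add_zero] at h
    have hε : Tendsto ε atTop (𝓝 0) := by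
      have h := (hs.add hinv).sqrt
      rwa [add_zero, Real.sqrt_zero] at h
    have hlim := (hinv.const_mul (128 * (1 + |LevyModel.bondLimit α β K|) ^ 2 / K ^ (-α))).add
      (hε.const_mul (512 * (1 + 2 * |LevyModel.bondLimit α β K|) * 28))
    simp only [mul_zero, add_zero] at hlim
    refine squeeze_zero' (Eventually.of_forall fun N => integral_nonneg fun ω =>
      LevyModel.gibbsExp_nonneg β _ fun τ => sq_nonneg _) ?_ hlim
    filter_upwards [eventually_ge_atTop 2,
      (LevyModel.tendsto_rpow_neg_div hα).eventually_le_const hK] with N hN hKN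
    have := LevyModel.isProbabilityMeasure_disorderLaw hN (hlaw N)
    have hN' : (0 : ℝ) < N := by exact_mod_cast (by omega : 0 < N)
    have hO0 : 0 ≤ ∫ x, LevyModel.overlapSq β x ∂(LevyModel.disorderMeasure α N) :=
      integral_nonneg fun x => LevyModel.overlapSq_nonneg β x
    have hc0 := LevyModel.tanhConst_nonneg hα β
    have hON := hO N hN
    have hs0 : 0 ≤ s N := by
      have : 0 ≤ r N := hO0.trans hON
      simp only [s]
      positivity
    have hε0 : 0 < ε N := Real.sqrt_pos.2 (by positivity)
    have hsε : s N / ε N ≤ ε N := by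
      rw [div_le_iff₀ hε0]
      simp only [ε]
      rw [Real.mul_self_sqrt (by positivity)]
      have : (0 : ℝ) ≤ 1 / N := by positivity
      linarith
    rw [LevyModel.integral_comp_couplings (hlaw N) (hindep N)
      (F := fun x => LevyModel.gibbsExp β x fun τ : Fin 2 → LevyModel.Config N =>
        (LevyModel.bondOverlap K x (τ 0) (τ 1) - LevyModel.bondLimit α β K) ^ 2)
      (LevyModel.measurable_gibbsExp_bond β K _)]
    refine (LevyModel.integral_bond_le hα₁ hα₂ hβ₀.le hN hKN hε0).trans ?_
    rw [mul_assoc (512 * _)]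
    refine add_le_add le_rfl (mul_le_mul_of_nonneg_left ?_ (by positivity))
    have h1 : 24 * (LevyModel.tanhConst α β / N) / ε N
        + 3 * (∫ x, LevyModel.overlapSq β x ∂(LevyModel.disorderMeasure α N)) / ε N
        ≤ s N / ε N := by
      rw [← add_div]
      refine div_le_div_of_nonneg_right ?_ hε0.le
      simp only [s]
      have h2 : 24 * (LevyModel.tanhConst α β / N) = 24 * LevyModel.tanhConst α β * (1 / N) := by
        ring
      linarith
    linarith
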